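/- Let $p$ be a prime, let $\mathbf{F}$ be a field of characteristic $p$, and let $V_2=\mathbf{F}^2$ be the natural two-dimensional representation of $SL_2(\mathbf{F}_p)$, where $\mathbf{F}_p\subseteq\mathbf{F}$ is the prime field. For $m\ge 1$ let $m V_2$ be the direct sum of $m$ copies of $V_2$ with the diagonal action. Let $\mathbf{F}[m V_2]=\mathbf{F}[x_1,y_1,\dots,x_m,y_m]$ be its coordinate ring, graded by total degree with all variables in degree $1$, on which $SL_2(\mathbf{F}_p)$ acts by the algebra automorphisms induced by $(g\cdot f)(v)=f(g^{-1}v)$, that is, by the dual action on the linear forms. Let $\mathbf{F}[m V_2]^{SL_2(\mathbf{F}_p)}$ be the subalgebra of invariants. The Noether number of this graded $\mathbf{F}$-algebra is the least integer $d$ such that it is generated as an $\mathbf{F}$-algebra by homogeneous elements of degree at most $d$. For every $m>2$, the Noether number of $\mathbf{F}[m V_2]^{SL_2(\mathbf{F}_p)}$ is at most $(p+m-2)(p-1)$. For $m=2$ it equals $p(p-1)$ if $p>2$, and it equals $3$ if $p=2$. -/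

import Mathlib

namespace SL2Vector

/-- The subalgebra `A` of a polynomial ring is generated, as an
algebra, by its homogeneous elements of degree at most `d`. -/
def GeneratedInDegreeLE {σ F : Type*} [Field F]
    (A : Subalgebra F (MvPolynomial σ F)) (d : ℕ) : Prop :=
  Algebra.adjoin F {f | f ∈ A ∧ ∃ n ≤ d, f.IsHomogeneous n} = A

/-- The Noether number of a (graded) subalgebra `A` of a polynomial ring: the least `d` such that
`A` is generated by homogeneous elements of degree at most `d`, and `⊤` if there is no such `d`. -/
noncomputable def noetherNumber {σ F : Type*} [Field F]
    (A : Subalgebra F (MvPolynomial σ F)) : ℕ∞ :=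
  ⨅ (d : ℕ) (_ : GeneratedInDegreeLE A d), (d : ℕ∞)

/-- The action of `SL_2(F)` by algebra endomorphisms on the coordinate ring `F[m V_2]` of the direct
sum of `m` copies of the natural module `V_2 = F²`, namely `(g · f)(v) = f(g⁻¹ v)`.
The variables `X (i, 0)` and `X (i, 1)` are the coordinates `x_i`, `y_i` on the `i`-th copy. -/
noncomputable def coordAction (F : Type*) [Field F] (m : ℕ) :
    Matrix.SpecialLinearGroup (Fin 2) F →*
      (MvPolynomial (Fin m × Fin 2) F →ₐ[F] MvPolynomial (Fin m × Fin 2) F) where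
  toFun g := MvPolynomial.aeval fun ik =>
    ∑ l : Fin 2, MvPolynomial.C (g⁻¹.1 ik.2 l) * MvPolynomial.X (ik.1, l)
  map_one' := by
    ext ⟨i, k⟩ : 1
    fin_cases k <;> simp [Fin.sum_univ_two]
  map_mul' g h := by
    ext ⟨i, k⟩ : 1
    rw [mul_inv_rev]
    simp only [MvPolynomial.aeval_X, AlgHom.mul_apply, map_mul,
      MvPolynomial.algHom_C, Matrix.SpecialLinearGroup.coe_mul, Matrix.mul_apply,
      Fin.sum_univ_two, map_add, MvPolynomial.algebraMap_eq]
    ring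

/-- The action is the usual one on polynomial functions. -/
theorem eval_coordAction {F : Type*} [Field F] {m : ℕ}
    (g : Matrix.SpecialLinearGroup (Fin 2) F) (f : MvPolynomial (Fin m × Fin 2) F)
    (v : Fin m → Fin 2 → F) :
    MvPolynomial.eval (fun ik => v ik.1 ik.2) (coordAction F m g f) =
      MvPolynomial.eval (fun ik => (g⁻¹.1.mulVec (v ik.1)) ik.2) f := by
  change MvPolynomial.eval _ (MvPolynomial.aeval _ f) = _
  induction f using MvPolynomial.induction_on with
  | C a => simp
  | add f g hf hg => rw [map_add, map_add, map_add, hf, hg]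
  | mul_X f n hf =>
    rw [map_mul, map_mul, map_mul, hf]
    simp only [MvPolynomial.aeval_X, MvPolynomial.eval_X, map_sum, map_mul, MvPolynomial.eval_C,
      Matrix.mulVec, dotProduct]

/-- The inclusion `SL_2(𝔽_p) → SL_2(F)` for a field `F` of characteristic `p`. -/
def slInclusion (p : ℕ) (F : Type*) [Field F] [CharP F p] :
    Matrix.SpecialLinearGroup (Fin 2) (ZMod p) →* Matrix.SpecialLinearGroup (Fin 2) F :=
  Matrix.SpecialLinearGroup.map (ZMod.castHom (dvd_refl p) F)

/-- The ring of vector invariants `F[m V_2]^{SL_2(𝔽_p)}`. -/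
noncomputable def vectorInvariants (p : ℕ) (F : Type*) [Field F] [CharP F p] (m : ℕ) :
    Subalgebra F (MvPolynomial (Fin m × Fin 2) F) where
  carrier := {f | ∀ g : Matrix.SpecialLinearGroup (Fin 2) (ZMod p),
    coordAction F m (slInclusion p F g) f = f}
  mul_mem' ha hb g := by rw [map_mul, ha g, hb g]
  add_mem' ha hb g := by rw [map_add, ha g, hb g]
  algebraMap_mem' r g := AlgHom.commutes _ r

end SL2Vector

namespace SL2Vector

open MvPolynomial

set_option linter.unusedSectionVars false

/-! Let `G = SL_2(𝔽_p)`, let `P` be its subgroup of lower unipotent matrices and let `T` be the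
diagonal torus. Write `u_ij`, `N_i`, `l_ij`, `d_b` for `uu`, `nn`, `ll`, `dd`; the `d_b` used are
those with `|b| = p - 1`.

Upper bound, structure. Modulo transfers from the trivial group, the `P`-invariants form the algebra
generated by the `x_i`, `u_ij` and `N_i` (`unip_mem_sup`). If the degree in some vector is at least
`p - 1`, Lagrange interpolation over `𝔽_p` in that vector splits off a transfer and leaves a
multiple of a norm. Otherwise all degrees are so small that the coefficient in Capelli's identity is
invertible, and degree can be moved into one fixed vector. Averaging over `T`, and then using that
`[G : P] = p² - 1` is `-1` in `F`, writes every `G`-invariant as a polynomial in the `u_ij`, `l_ij`,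
`d_b` plus a transfer `trG h` (`exists_uld_add_trG`). These generators have degrees `2`, `p + 1` and
`p(p - 1)`.

Upper bound, transfers. It remains to decompose `trG h` when `h` has large degree `n`, by induction
on `n`. As `trG` is linear over invariants, `h` matters only modulo the `u_ij`, hence only through
the binary form obtained by making all vectors equal (`mem_uuForms_of_toPoly`). If `h` has degree at
least `p` in some vector, it matters, modulo the `l_ij`, only through its values on the projective
line over `𝔽_p` (`trG_mem_of_vanishing`). Since `G` is transitive on these points, one form
supported at a single point whose transfer decomposes suffices (`trG_mem_of_indicator`). Such a form
is found when `(p - 1) ∤ n` (its transfer vanishes by torus weights), when a factor `d_b` fits into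
the multidegree, and in the one remaining case `m = 2`, `n = p² - 1`.

Lower bounds. Restricting all vectors to the line `(0, T)` kills every homogeneous invariant whose
degree is not a multiple of `p(p - 1)`, while some `d_b` restricts to `T ^ (p(p - 1))`. For `p = 2`
there are no linear invariants, so degrees at most `2` generate only even degrees and miss `l_01`,
of degree `3`. -/

/-- The linear substitution of a `2 × 2` matrix over the prime field in every pair of variables. -/
noncomputable def gsub {p : ℕ} {F : Type*} [Field F] [CharP F p] {m : ℕ}
    (g : Matrix.SpecialLinearGroup (Fin 2) (ZMod p)) :
    MvPolynomial (Fin m × Fin 2) F →ₐ[F] MvPolynomial (Fin m × Fin 2) F :=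
  MvPolynomial.aeval fun ik =>
    ∑ l : Fin 2, C (ZMod.castHom (dvd_refl p) F (g.1 ik.2 l)) * X (ik.1, l)

/-! ### The group action as linear substitution -/

section Action

variable {p : ℕ} {F : Type*} [Field F] [CharP F p] {m : ℕ}

theorem gsub_X (g : Matrix.SpecialLinearGroup (Fin 2) (ZMod p)) (i : Fin m) (k : Fin 2) :
    gsub g (X (i, k) : MvPolynomial (Fin m × Fin 2) F) =
      C (ZMod.castHom (dvd_refl p) F (g.1 k 0)) * X (i, 0) +
      C (ZMod.castHom (dvd_refl p) F (g.1 k 1)) * X (i, 1) := by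
  simp [gsub, Fin.sum_univ_two]

theorem coordAction_eq_gsub (g : Matrix.SpecialLinearGroup (Fin 2) (ZMod p)) :
    coordAction F m (slInclusion p F g) = gsub g⁻¹ := by
  ext ⟨i, k⟩ : 1
  rw [gsub_X]
  change MvPolynomial.aeval _ _ = _
  rw [aeval_X, ← map_inv, Fin.sum_univ_two]
  rfl

/-- Substitution reverses products, so a `P`-invariant has the same image under all elements of a
coset `P h`. This is why cosets are indexed by first rows, which left multiplication by `P`
preserves. -/
theorem gsub_gsub (g h : Matrix.SpecialLinearGroup (Fin 2) (ZMod p))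
    (f : MvPolynomial (Fin m × Fin 2) F) : gsub g (gsub h f) = gsub (h * g) f := by
  have := congrArg (fun φ => φ f) (map_mul (coordAction F m) (slInclusion p F g⁻¹)
    (slInclusion p F h⁻¹))
  simp only [← map_mul, coordAction_eq_gsub, AlgHom.mul_apply, inv_inv, mul_inv_rev] at this
  exact this.symm

theorem mem_vectorInvariants {f : MvPolynomial (Fin m × Fin 2) F} :
    f ∈ vectorInvariants p F m ↔
      ∀ g : Matrix.SpecialLinearGroup (Fin 2) (ZMod p), gsub g f = f := by
  constructor
  · intro h g
    have := h g⁻¹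
    rwa [coordAction_eq_gsub, inv_inv] at this
  · intro h g
    rw [coordAction_eq_gsub]; exact h _

end Action

/-! ### Cosets of the unipotent subgroup -/

/-- The lower unipotent matrices, acting by `y ↦ y + s x`. -/
def unip {p : ℕ} (s : ZMod p) : Matrix.SpecialLinearGroup (Fin 2) (ZMod p) :=
  ⟨!![1, 0; s, 1], by simp [Matrix.det_fin_two]⟩

/-- A matrix in `SL_2` with a prescribed nonzero first row. -/
def rowRep {p : ℕ} [Fact p.Prime] (v : ZMod p × ZMod p) :
    Matrix.SpecialLinearGroup (Fin 2) (ZMod p) :=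
  if h : v.2 = 0 then
    if hv : v.1 = 0 then 1 else ⟨!![v.1, 0; 0, v.1⁻¹], by simp [Matrix.det_fin_two, hv]⟩
  else ⟨!![v.1, v.2; -v.2⁻¹, 0], by simp [Matrix.det_fin_two, h]⟩

section Group

variable {p : ℕ}

theorem sl_mul_apply (g h : Matrix.SpecialLinearGroup (Fin 2) (ZMod p)) (i j : Fin 2) :
    (g * h).1 i j = g.1 i 0 * h.1 0 j + g.1 i 1 * h.1 1 j := by
  rw [Matrix.SpecialLinearGroup.coe_mul, Matrix.mul_apply, Fin.sum_univ_two]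

theorem unip_mul (s t : ZMod p) : unip s * unip t = unip (s + t) := by
  apply Subtype.ext
  ext i j
  rw [sl_mul_apply]
  fin_cases i <;> fin_cases j <;> simp [unip]

theorem unip_inj {s t : ZMod p} (h : unip s = unip t) : s = t := by
  have := congrArg (fun g => g.1 1 0) h
  simpa [unip] using this

theorem unip_mul_row (s : ZMod p) (g : Matrix.SpecialLinearGroup (Fin 2) (ZMod p)) (k : Fin 2) :
    (unip s * g).1 0 k = g.1 0 k := by
  rw [sl_mul_apply]
  simp [unip]

variable [Fact p.Prime]

theorem rowRep_row {v : ZMod p × ZMod p} (hv : v ≠ 0) :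
    (rowRep v).1 0 0 = v.1 ∧ (rowRep v).1 0 1 = v.2 := by
  obtain ⟨a, b⟩ := v
  by_cases h : b = 0
  · have ha : a ≠ 0 := fun h' => hv (Prod.ext h' h)
    simp [rowRep, h, ha]
  · simp [rowRep, h]

theorem row_ne_zero (g : Matrix.SpecialLinearGroup (Fin 2) (ZMod p)) :
    (g.1 0 0, g.1 0 1) ≠ 0 := by
  intro h
  have := g.2
  rw [Matrix.det_fin_two] at this
  simp_all [Prod.ext_iff]

/-- Two matrices with the same first row differ by a unipotent matrix on the left. -/
theorem eq_unip_mul {g h : Matrix.SpecialLinearGroup (Fin 2) (ZMod p)}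
    (h0 : g.1 0 0 = h.1 0 0) (h1 : g.1 0 1 = h.1 0 1) :
    g = unip (h.1 1 1 * g.1 1 0 - h.1 1 0 * g.1 1 1) * h := by
  have dg := g.2
  have dh := h.2
  rw [Matrix.det_fin_two] at dg dh
  rw [h0, h1] at dg
  apply Subtype.ext
  ext i j
  rw [sl_mul_apply]
  fin_cases i <;> fin_cases j <;> simp [unip, h0, h1]
  · linear_combination (-g.1 1 0) * dh + h.1 1 0 * dg
  · linear_combination (-g.1 1 1) * dh + h.1 1 1 * dg

/-- Summation over the group, by right cosets of the unipotent subgroup. -/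
theorem sum_group {M : Type*} [AddCommMonoid M]
    (Φ : Matrix.SpecialLinearGroup (Fin 2) (ZMod p) → M) :
    ∑ g, Φ g = ∑ v ∈ Finset.univ.erase (0 : ZMod p × ZMod p), ∑ s, Φ (unip s * rowRep v) := by
  rw [← Finset.sum_product']
  symm
  refine Finset.sum_bij (fun q _ => unip q.2 * rowRep q.1) (fun _ _ => Finset.mem_univ _)
    ?_ ?_ (fun _ _ => rfl)
  · rintro ⟨v, s⟩ hv ⟨w, t⟩ hw h
    simp only [Finset.mem_product, Finset.mem_erase, Finset.mem_univ, and_true] at hv hw h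
    have e0 := congrArg (fun g => g.1 0 0) h
    have e1 := congrArg (fun g => g.1 0 1) h
    simp only [unip_mul_row, (rowRep_row hv).1, (rowRep_row hv).2, (rowRep_row hw).1,
      (rowRep_row hw).2] at e0 e1
    obtain rfl : v = w := Prod.ext e0 e1
    rw [unip_inj (mul_right_cancel h)]
  · intro g _
    have e := eq_unip_mul (g := g) (h := rowRep (g.1 0 0, g.1 0 1))
      (rowRep_row (row_ne_zero g)).1.symm (rowRep_row (row_ne_zero g)).2.symm
    exact ⟨((g.1 0 0, g.1 0 1), _), by simpa using row_ne_zero g, e.symm⟩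

/-- The action of the group on row vectors, as a permutation. -/
def rowEquiv (g : Matrix.SpecialLinearGroup (Fin 2) (ZMod p)) : ZMod p × ZMod p ≃ ZMod p × ZMod p where
  toFun v := (v.1 * g.1 0 0 + v.2 * g.1 1 0, v.1 * g.1 0 1 + v.2 * g.1 1 1)
  invFun v := (v.1 * g.1 1 1 - v.2 * g.1 1 0, -v.1 * g.1 0 1 + v.2 * g.1 0 0)
  left_inv v := by
    have := g.2
    rw [Matrix.det_fin_two] at this
    ext
    · linear_combination v.1 * this
    · linear_combination v.2 * this
  right_inv v := by
    have := g.2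
    rw [Matrix.det_fin_two] at this
    ext
    · linear_combination v.1 * this
    · linear_combination v.2 * this

end Group

/-! ### Transfers -/

/-- The transfer from the trivial group to the unipotent subgroup. -/
noncomputable def trP (p : ℕ) [Fact p.Prime] (F : Type*) [Field F] [CharP F p] (m : ℕ) :
    MvPolynomial (Fin m × Fin 2) F →ₗ[F] MvPolynomial (Fin m × Fin 2) F :=
  ∑ s : ZMod p, (gsub (unip s)).toLinearMap

/-- The transfer from the trivial group to `SL_2(𝔽_p)`. -/
noncomputable def trG (p : ℕ) [Fact p.Prime] (F : Type*) [Field F] [CharP F p] (m : ℕ) :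
    MvPolynomial (Fin m × Fin 2) F →ₗ[F] MvPolynomial (Fin m × Fin 2) F :=
  ∑ g : Matrix.SpecialLinearGroup (Fin 2) (ZMod p), (gsub g).toLinearMap

/-- The relative transfer from the unipotent subgroup to `SL_2(𝔽_p)`. -/
noncomputable def trRel (p : ℕ) [Fact p.Prime] (F : Type*) [Field F] [CharP F p] (m : ℕ) :
    MvPolynomial (Fin m × Fin 2) F →ₗ[F] MvPolynomial (Fin m × Fin 2) F :=
  ∑ v ∈ Finset.univ.erase (0 : ZMod p × ZMod p), (gsub (rowRep v)).toLinearMap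

/-- The invariants of the unipotent subgroup. -/
noncomputable def unipInvariants (p : ℕ) (F : Type*) [Field F] [CharP F p] (m : ℕ) :
    Subalgebra F (MvPolynomial (Fin m × Fin 2) F) where
  carrier := {f | ∀ s : ZMod p, gsub (unip s) f = f}
  mul_mem' ha hb g := by rw [map_mul, ha g, hb g]
  add_mem' ha hb g := by rw [map_add, ha g, hb g]
  algebraMap_mem' r g := AlgHom.commutes _ r

section Transfer

theorem invariants_le_unip {p : ℕ} {F : Type*} [Field F] [CharP F p] {m : ℕ} :
    vectorInvariants p F m ≤ unipInvariants p F m :=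
  fun _ hf _ => mem_vectorInvariants.1 hf _

variable {p : ℕ} [Fact p.Prime] {F : Type*} [Field F] [CharP F p] {m : ℕ}

theorem trP_apply (f : MvPolynomial (Fin m × Fin 2) F) :
    trP p F m f = ∑ s : ZMod p, gsub (unip s) f := by
  simp [trP]

theorem trG_apply (f : MvPolynomial (Fin m × Fin 2) F) :
    trG p F m f = ∑ g : Matrix.SpecialLinearGroup (Fin 2) (ZMod p), gsub g f := by
  simp [trG]

theorem trRel_apply (f : MvPolynomial (Fin m × Fin 2) F) :
    trRel p F m f = ∑ v ∈ Finset.univ.erase (0 : ZMod p × ZMod p), gsub (rowRep v) f := by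
  simp [trRel]

theorem trG_mem (f : MvPolynomial (Fin m × Fin 2) F) : trG p F m f ∈ vectorInvariants p F m := by
  rw [mem_vectorInvariants]
  intro g
  simp only [trG_apply, map_sum, gsub_gsub]
  exact Fintype.sum_equiv (Equiv.mulRight g) _ _ fun _ => rfl

theorem trP_mem (f : MvPolynomial (Fin m × Fin 2) F) : trP p F m f ∈ unipInvariants p F m := by
  intro t
  simp only [trP_apply, map_sum, gsub_gsub, unip_mul]
  exact Fintype.sum_equiv (Equiv.addRight t) _ _ fun _ => rfl

theorem trG_gsub (g : Matrix.SpecialLinearGroup (Fin 2) (ZMod p))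
    (f : MvPolynomial (Fin m × Fin 2) F) : trG p F m (gsub g f) = trG p F m f := by
  simp only [trG_apply, gsub_gsub]
  exact Fintype.sum_equiv (Equiv.mulLeft g) _ _ fun _ => rfl

theorem trG_mul {k : MvPolynomial (Fin m × Fin 2) F} (hk : k ∈ vectorInvariants p F m)
    (f : MvPolynomial (Fin m × Fin 2) F) : trG p F m (k * f) = k * trG p F m f := by
  simp only [trG_apply, map_mul, mem_vectorInvariants.1 hk, Finset.mul_sum]

theorem trP_mul {k : MvPolynomial (Fin m × Fin 2) F} (hk : k ∈ unipInvariants p F m)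
    (f : MvPolynomial (Fin m × Fin 2) F) : trP p F m (k * f) = k * trP p F m f := by
  simp only [trP_apply, map_mul, Finset.mul_sum]
  exact Finset.sum_congr rfl fun s _ => by rw [hk s]

theorem trRel_trP (f : MvPolynomial (Fin m × Fin 2) F) :
    trRel p F m (trP p F m f) = trG p F m f := by
  rw [trG_apply, sum_group, trRel_apply]
  refine Finset.sum_congr rfl fun v _ => ?_
  simp only [trP_apply, map_sum, gsub_gsub]

/-- The number of cosets is `p² - 1`, which is `-1` in `F`. So the relative transfer is invertible
on invariants of the whole group. -/
theorem trRel_of_mem {k : MvPolynomial (Fin m × Fin 2) F} (hk : k ∈ vectorInvariants p F m) :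
    trRel p F m k = -k := by
  have hp : 1 ≤ p * p := Nat.mul_pos (Fact.out : p.Prime).pos (Fact.out : p.Prime).pos
  simp only [trRel_apply, mem_vectorInvariants.1 hk, Finset.sum_const,
    Finset.card_erase_of_mem (Finset.mem_univ _), Finset.card_univ, Fintype.card_prod, ZMod.card,
    nsmul_eq_mul]
  rw [Nat.cast_sub hp]
  simp

/-- Right multiplication by `g` permutes the cosets as it permutes nonzero rows; the unipotent
discrepancy between representatives is absorbed by `f`. -/
theorem trRel_mem {f : MvPolynomial (Fin m × Fin 2) F} (hf : f ∈ unipInvariants p F m) :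
    trRel p F m f ∈ vectorInvariants p F m := by
  rw [mem_vectorInvariants]
  intro g
  simp only [trRel_apply, map_sum, gsub_gsub]
  have key : ∀ v : ZMod p × ZMod p, v ≠ 0 →
      gsub (rowRep v * g) f = gsub (rowRep (rowEquiv g v)) f := by
    intro v hv
    have h0 : rowEquiv g (0 : ZMod p × ZMod p) = 0 := by simp [rowEquiv]
    have hv' : rowEquiv g v ≠ 0 := fun h => hv ((rowEquiv g).injective (h.trans h0.symm))
    have e := eq_unip_mul (g := rowRep v * g) (h := rowRep (rowEquiv g v))
      (by rw [(rowRep_row hv').1]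
          simp [sl_mul_apply, rowRep_row hv, rowEquiv])
      (by rw [(rowRep_row hv').2]
          simp [sl_mul_apply, rowRep_row hv, rowEquiv])
    rw [e, ← gsub_gsub, hf]
  refine Finset.sum_equiv (rowEquiv g) (fun v => ?_) (fun v hv => key v (Finset.ne_of_mem_erase hv))
  simp only [Finset.mem_erase, Finset.mem_univ, and_true]
  have : rowEquiv g (0 : ZMod p × ZMod p) = 0 := by simp [rowEquiv]
  rw [not_iff_not]
  exact ⟨fun h => h ▸ this, fun h => (rowEquiv g).injective (h.trans this.symm)⟩

theorem rowRep_eq_mul_unip (a b : ZMod p) (hb : b ≠ 0) :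
    rowRep (a, b) = rowRep (0, b) * unip (b⁻¹ * a) := by
  apply Subtype.ext
  ext i j
  rw [sl_mul_apply]
  fin_cases i <;> fin_cases j <;> simp [unip, rowRep, hb]

/-- Bruhat decomposition: rows `(a, 0)` come from the torus, while for each `b ≠ 0` the rows `(a,
b)` form one free orbit of `P` acting on the right. -/
theorem trRel_eq (f : MvPolynomial (Fin m × Fin 2) F) :
    trRel p F m f = ∑ a ∈ Finset.univ.erase (0 : ZMod p), gsub (rowRep (a, 0)) f +
      trP p F m (∑ b ∈ Finset.univ.erase (0 : ZMod p), gsub (rowRep (0, b)) f) := by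
  have h1 : ∀ b ∈ Finset.univ.erase (0 : ZMod p), trP p F m (gsub (rowRep (0, b)) f) =
      ∑ a, gsub (rowRep (a, b)) f := by
    intro b hb
    rw [trP_apply]
    simp only [gsub_gsub]
    have hb := Finset.ne_of_mem_erase hb
    refine (Fintype.sum_equiv (Equiv.mulLeft₀ b⁻¹ (inv_ne_zero hb)) _ _ fun a => ?_).symm
    rw [rowRep_eq_mul_unip a b hb]; rfl
  rw [map_sum, Finset.sum_congr rfl h1, trRel_apply, Finset.sum_comm, ← Finset.sum_product']
  have : Finset.univ.erase (0 : ZMod p × ZMod p) =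
      (Finset.univ.erase (0 : ZMod p) ×ˢ {0}) ∪ (Finset.univ ×ˢ Finset.univ.erase (0 : ZMod p)) := by
    ext ⟨a, b⟩
    simp only [Finset.mem_erase, Finset.mem_union, Finset.mem_product, Finset.mem_singleton,
      Finset.mem_univ, ne_eq, Prod.mk_eq_zero]
    tauto
  rw [this, Finset.sum_union, Finset.sum_product (s := Finset.univ.erase (0 : ZMod p))]
  · simp only [Finset.sum_singleton]
  · rw [Finset.disjoint_left]
    rintro ⟨a, b⟩ h h'
    simp_all

end Transfer

/-! ### Weighted gradings -/

section Weighted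

variable {F : Type*} [Field F] {σ τ M : Type*} [AddCommMonoid M]

theorem isWeightedHomogeneous_aeval {w : σ → M} {w' : τ → M} {φ : σ → MvPolynomial τ F}
    (h : ∀ i, IsWeightedHomogeneous w' (φ i) (w i)) {f : MvPolynomial σ F} {n : M}
    (hf : IsWeightedHomogeneous w f n) : IsWeightedHomogeneous w' (aeval φ f) n := by
  induction hf using IsWeightedHomogeneous.induction_on with
  | zero => rw [map_zero]; exact isWeightedHomogeneous_zero _ _ _
  | add p q _ _ hp hq => rw [map_add]; exact hp.add hq
  | monomial d r hr =>
    rw [aeval_monomial, algebraMap_eq]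
    refine IsWeightedHomogeneous.C_mul ?_ r
    rw [← hr, Finsupp.weight_apply]
    exact IsWeightedHomogeneous.prod _ _ _ fun i _ => (h i).pow _

theorem weightedHomogeneousComponent_map {w : σ → M} {w' : τ → M}
    (ψ : MvPolynomial σ F →ₗ[F] MvPolynomial τ F)
    (h : ∀ n f, IsWeightedHomogeneous w f n → IsWeightedHomogeneous w' (ψ f) n)
    (n : M) (f : MvPolynomial σ F) :
    weightedHomogeneousComponent w' n (ψ f) = ψ (weightedHomogeneousComponent w n f) := by
  classical
  have : weightedHomogeneousComponent w' n ∘ₗ ψ = ψ ∘ₗ weightedHomogeneousComponent w n := by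
    apply MvPolynomial.linearMap_ext
    intro d
    ext
    have hd := isWeightedHomogeneous_monomial w d (1 : F) rfl
    have hd' := h _ _ hd
    simp only [LinearMap.comp_apply]
    rw [weightedHomogeneousComponent_of_mem (m := n) hd,
      weightedHomogeneousComponent_of_mem (m := n) hd']
    split_ifs <;> simp
  exact congrArg (fun φ => φ f) this

theorem mem_of_components {w : σ → M} (W : Submodule F (MvPolynomial σ F)) (f : MvPolynomial σ F)
    (h : ∀ n, weightedHomogeneousComponent w n f ∈ W) : f ∈ W := by
  rw [← sum_weightedHomogeneousComponent w f]
  exact finsum_induction (· ∈ W) W.zero_mem (fun _ _ => W.add_mem) h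

theorem IsWeightedHomogeneous.map_weight {N : Type*} [AddCommMonoid N] {w : σ → M} (φ : M →+ N)
    {f : MvPolynomial σ F} {n : M} (hf : IsWeightedHomogeneous w f n) :
    IsWeightedHomogeneous (fun i => φ (w i)) f (φ n) := by
  intro d hd
  rw [← hf hd]
  simp [Finsupp.weight_apply, Finsupp.sum, map_sum]

end Weighted

/-! ### Multidegrees -/

/-- The grading by multidegree, which counts the variables of every copy of the module. -/
def mdeg {m : ℕ} (ik : Fin m × Fin 2) : Fin m → ℕ := Pi.single ik.1 1

/-- Being homogeneous of multidegree `e`. -/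
abbrev IsMulti {m : ℕ} {F : Type*} [Field F] (f : MvPolynomial (Fin m × Fin 2) F)
    (e : Fin m → ℕ) : Prop :=
  IsWeightedHomogeneous mdeg f e

section Multi

variable {p : ℕ} {F : Type*} [Field F] [CharP F p] {m : ℕ}

theorem weight_mdeg (d : Fin m × Fin 2 →₀ ℕ) (i : Fin m) :
    Finsupp.weight mdeg d i = d (i, 0) + d (i, 1) := by
  classical
  rw [Finsupp.weight_eq_sum, Finset.sum_apply, Fintype.sum_prod_type,
    Finset.sum_eq_single i]
  · simp [mdeg, Fin.sum_univ_two]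
  · intro j _ hj
    simp [mdeg, hj.symm]
  · simp

theorem isMulti_X {F : Type*} [Field F] (i : Fin m) (k : Fin 2) :
    IsMulti (X (i, k) : MvPolynomial (Fin m × Fin 2) F) (Pi.single i 1) :=
  isWeightedHomogeneous_X _ _ _

theorem IsMulti.gsub {f : MvPolynomial (Fin m × Fin 2) F} {e : Fin m → ℕ} (hf : IsMulti f e)
    (g : Matrix.SpecialLinearGroup (Fin 2) (ZMod p)) : IsMulti (gsub g f) e := by
  refine isWeightedHomogeneous_aeval (fun ik => ?_) hf
  exact IsWeightedHomogeneous.sum _ _ _ fun l _ => (isMulti_X ik.1 l).C_mul _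

theorem IsMulti.isHomogeneous {F : Type*} [Field F] {f : MvPolynomial (Fin m × Fin 2) F}
    {e : Fin m → ℕ} (hf : IsMulti f e) : f.IsHomogeneous (∑ i, e i) := by
  have h := IsWeightedHomogeneous.map_weight
    (∑ i : Fin m, Pi.evalAddMonoidHom (fun _ => ℕ) i) hf
  have e1 : (fun ik : Fin m × Fin 2 => (∑ i : Fin m, Pi.evalAddMonoidHom (fun _ => ℕ) i)
      (mdeg ik)) = 1 := by
    ext ik
    simp [mdeg]
  rw [e1, AddMonoidHom.finsetSum_apply] at h
  exact h

theorem isMulti_component_gsub (g : Matrix.SpecialLinearGroup (Fin 2) (ZMod p))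
    (e : Fin m → ℕ) (f : MvPolynomial (Fin m × Fin 2) F) :
    weightedHomogeneousComponent mdeg e (gsub g f) =
      gsub g (weightedHomogeneousComponent mdeg e f) :=
  weightedHomogeneousComponent_map (gsub g).toLinearMap (fun _ _ hf => IsMulti.gsub hf g) e f

theorem component_mem_unip {f : MvPolynomial (Fin m × Fin 2) F} (hf : f ∈ unipInvariants p F m)
    (e : Fin m → ℕ) : weightedHomogeneousComponent mdeg e f ∈ unipInvariants p F m := by
  intro s
  rw [← isMulti_component_gsub, hf s]

end Multi

/-! ### The basic invariants -/

section Elements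

variable {F : Type*} [Field F] {m : ℕ}

/-- The invariants `x_i y_j - x_j y_i` of degree two. -/
noncomputable def uu (i j : Fin m) : MvPolynomial (Fin m × Fin 2) F :=
  X (i, 0) * X (j, 1) - X (j, 0) * X (i, 1)

/-- The orbit product of `y_i` under the unipotent subgroup. -/
noncomputable def nn (p : ℕ) (i : Fin m) : MvPolynomial (Fin m × Fin 2) F :=
  X (i, 1) ^ p - X (i, 0) ^ (p - 1) * X (i, 1)

/-- The polarised first Dickson invariants. -/
noncomputable def ll (p : ℕ) (i j : Fin m) : MvPolynomial (Fin m × Fin 2) F :=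
  X (i, 0) * X (j, 1) ^ p - X (j, 0) ^ p * X (i, 1)

variable {p : ℕ} [Fact p.Prime] [CharP F p]

theorem castHom_pow (c : ZMod p) :
    (ZMod.castHom (dvd_refl p) F c) ^ p = ZMod.castHom (dvd_refl p) F c := by
  rw [← map_pow, ZMod.pow_card]

theorem ll_eq (i j : Fin m) :
    (ll p i j : MvPolynomial (Fin m × Fin 2) F) =
      X (i, 0) * nn p j + X (j, 0) ^ (p - 1) * uu i j := by
  have hp : X (j, 0) ^ p = X (j, 0) ^ (p - 1) * (X (j, 0) : MvPolynomial (Fin m × Fin 2) F) :=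
    (pow_sub_one_mul (Fact.out : p.Prime).ne_zero _).symm
  rw [ll, nn, uu, hp]
  ring

theorem uu_mem (i j : Fin m) : (uu i j : MvPolynomial (Fin m × Fin 2) F) ∈
    vectorInvariants p F m := by
  rw [mem_vectorInvariants]
  intro g
  have h := congrArg (fun c => C (ZMod.castHom (dvd_refl p) F c) (σ := Fin m × Fin 2)) g.2
  simp only [Matrix.det_fin_two, map_sub, map_mul, map_one] at h
  simp only [uu, map_sub, map_mul, gsub_X]
  linear_combination (X (i, 0) * X (j, 1) - X (j, 0) * X (i, 1)) * h

theorem ll_mem (i j : Fin m) : (ll p i j : MvPolynomial (Fin m × Fin 2) F) ∈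
    vectorInvariants p F m := by
  rw [mem_vectorInvariants]
  intro g
  have h := congrArg (fun c => C (ZMod.castHom (dvd_refl p) F c) (σ := Fin m × Fin 2)) g.2
  simp only [Matrix.det_fin_two, map_sub, map_mul, map_one] at h
  simp only [ll, map_sub, map_mul, map_pow, gsub_X, add_pow_char, mul_pow, ← C_pow, castHom_pow]
  linear_combination (X (i, 0) * X (j, 1) ^ p - X (j, 0) ^ p * X (i, 1)) * h

theorem X_mem_unip (i : Fin m) :
    (X (i, 0) : MvPolynomial (Fin m × Fin 2) F) ∈ unipInvariants p F m := by
  intro s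
  rw [gsub_X]
  simp [unip]

theorem gsub_unip_y (s : ZMod p) (i : Fin m) :
    gsub (unip s) (X (i, 1) : MvPolynomial (Fin m × Fin 2) F) =
      X (i, 1) + C (ZMod.castHom (dvd_refl p) F s) * X (i, 0) := by
  rw [gsub_X]
  simp [unip, add_comm]

theorem gsub_unip_x (s : ZMod p) (i : Fin m) :
    gsub (unip s) (X (i, 0) : MvPolynomial (Fin m × Fin 2) F) = X (i, 0) := X_mem_unip i s

theorem nn_mem_unip (i : Fin m) :
    (nn p i : MvPolynomial (Fin m × Fin 2) F) ∈ unipInvariants p F m := by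
  intro s
  have hp : X (i, 0) ^ p = X (i, 0) ^ (p - 1) * (X (i, 0) : MvPolynomial (Fin m × Fin 2) F) :=
    (pow_sub_one_mul (Fact.out : p.Prime).ne_zero _).symm
  simp only [nn, map_sub, map_mul, map_pow, gsub_unip_y, gsub_unip_x, add_pow_char, mul_pow,
    ← C_pow, castHom_pow, hp]
  ring

theorem isMulti_uu {F : Type*} [Field F] (i j : Fin m) :
    IsMulti (uu i j : MvPolynomial (Fin m × Fin 2) F) (Pi.single i 1 + Pi.single j 1) := by
  refine ((isMulti_X i 0).mul (isMulti_X j 1)).sub ?_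
  rw [add_comm]
  exact (isMulti_X j 0).mul (isMulti_X i 1)

theorem isMulti_nn (i : Fin m) :
    IsMulti (nn p i : MvPolynomial (Fin m × Fin 2) F) (p • Pi.single i 1) := by
  refine ((isMulti_X i 1).pow p).sub ?_
  convert! ((isMulti_X i 0).pow (p - 1)).mul (isMulti_X (F := F) i 1) using 1
  rw [← succ_nsmul, Nat.sub_add_cancel (Fact.out : p.Prime).one_le]

theorem isMulti_ll (i j : Fin m) :
    IsMulti (ll p i j : MvPolynomial (Fin m × Fin 2) F) (Pi.single i 1 + p • Pi.single j 1) := by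
  refine ((isMulti_X i 0).mul ((isMulti_X j 1).pow p)).sub ?_
  rw [add_comm]
  exact ((isMulti_X j 0).pow p).mul (isMulti_X i 1)

end Elements

/-! ### Power sums and interpolation over the prime field -/

section PowerSums

variable {p : ℕ} [Fact p.Prime] {R : Type*} [CommRing R] (φ : ZMod p →+* R)

theorem sum_map_pow {i : ℕ} (hi : i ≠ 0) :
    ∑ s : ZMod p, φ s ^ i = if p - 1 ∣ i then -1 else 0 := by
  classical
  have h := FiniteField.sum_pow_units (ZMod p) i
  rw [ZMod.card] at h
  have h2 : ∑ s : ZMod p, s ^ i = ∑ x : (ZMod p)ˣ, (x ^ i : ZMod p) := by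
    rw [← Finset.sum_erase (f := fun s : ZMod p => s ^ i) _ (zero_pow hi)]
    refine (Finset.sum_bij (fun (x : (ZMod p)ˣ) _ => (x : ZMod p)) (fun x _ => ?_)
      (fun x _ y _ hxy => Units.ext hxy) (fun b hb => ?_) (fun _ _ => rfl)).symm
    · simp
    · exact ⟨Units.mk0 b (Finset.ne_of_mem_erase hb), Finset.mem_univ _, rfl⟩
  calc ∑ s : ZMod p, φ s ^ i = φ (∑ s : ZMod p, s ^ i) := by rw [map_sum]; simp only [map_pow]
    _ = _ := by rw [h2, h]; split_ifs <;> simp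

theorem sum_map_pow_zero [CharP R p] : ∑ s : ZMod p, φ s ^ 0 = 0 := by
  simp [Finset.card_univ, ZMod.card]

theorem sum_map_pow_of_lt [CharP R p] {i : ℕ} (hi : i < p - 1) : ∑ s : ZMod p, φ s ^ i = 0 := by
  rcases eq_or_ne i 0 with rfl | h0
  · exact sum_map_pow_zero φ
  · rw [sum_map_pow φ h0, if_neg fun h => (Nat.le_of_dvd (Nat.pos_of_ne_zero h0) h).not_gt hi]

theorem sum_eval_map [CharP R p] (Q : Polynomial R) (hQ : Q.natDegree ≤ p - 1) :
    ∑ s : ZMod p, Q.eval (φ s) = -Q.coeff (p - 1) := by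
  have hp := (Fact.out : p.Prime).two_le
  have : ∀ s : ZMod p, Q.eval (φ s) = ∑ i ∈ Finset.range (p - 1 + 1), Q.coeff i * φ s ^ i :=
    fun s => Polynomial.eval_eq_sum_range' (by lia) _
  simp only [this]
  rw [Finset.sum_comm]
  simp only [← Finset.mul_sum]
  rw [Finset.sum_range_succ, Finset.sum_eq_zero, sum_map_pow φ (by lia), if_pos dvd_rfl]
  · simp
  · intro i hi
    rw [sum_map_pow_of_lt φ (Finset.mem_range.1 hi), mul_zero]

/-- Divide `(a - b)^p = a^p - b^p` by `a - b`. If `a = b`, the right side is `p` equal terms. -/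
theorem sub_pow_char_sub_one [IsDomain R] [CharP R p] (a b : R) :
    (a - b) ^ (p - 1) = ∑ k ∈ Finset.range p, a ^ (p - 1 - k) * b ^ k := by
  rcases eq_or_ne a b with rfl | hab
  · have hp := (Fact.out : p.Prime).two_le
    rw [sub_self, zero_pow (by lia)]
    have : ∀ k ∈ Finset.range p, a ^ (p - 1 - k) * a ^ k = a ^ (p - 1) := by
      intro k hk
      rw [← pow_add]
      congr 1
      have := Finset.mem_range.1 hk
      lia
    rw [Finset.sum_congr rfl this]
    simp
  · refine mul_left_cancel₀ (sub_ne_zero.2 hab) ?_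
    rw [mul_pow_sub_one (Fact.out : p.Prime).ne_zero, sub_pow_char,
      ← (Commute.all a b).mul_geom_sum₂, ← Finset.sum_range_reflect]
    congr 1
    refine Finset.sum_congr rfl fun k hk => ?_
    have := Finset.mem_range.1 hk
    rw [show p - 1 - (p - 1 - k) = k by lia]

/-- Homogenised Lagrange interpolation: `x^(p-1) - (y - t x)^(p-1)` is the indicator form of the
point `y = t x` among the affine `𝔽_p`-points. The exponents are small enough that expanding and
summing powers of `t` leaves the stated monomial exactly. -/
theorem interpolation [IsDomain R] [CharP R p] (x y : R) {l : ℕ} (hl : l ≤ p - 1) :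
    ∑ t : ZMod p, φ t ^ l * (x ^ (p - 1) - (y - φ t * x) ^ (p - 1)) = x ^ (p - 1 - l) * y ^ l := by
  have hp := (Fact.out : p.Prime).two_le
  have h1 : ∀ t : ZMod p, φ t ^ l * (x ^ (p - 1) - (y - φ t * x) ^ (p - 1)) =
      x ^ (p - 1) * φ t ^ l - ∑ k ∈ Finset.range p, y ^ (p - 1 - k) * x ^ k * φ t ^ (l + k) := by
    intro t
    rw [sub_pow_char_sub_one, mul_sub, Finset.mul_sum]
    congr 1
    · ring
    · refine Finset.sum_congr rfl fun k _ => ?_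
      rw [mul_pow, pow_add]
      ring
  simp only [h1]
  rw [Finset.sum_sub_distrib, Finset.sum_comm]
  simp only [← Finset.mul_sum]
  rcases hl.lt_or_eq with hl | rfl
  · rw [sum_map_pow_of_lt φ hl, Finset.sum_eq_single (p - 1 - l)]
    · rw [show l + (p - 1 - l) = p - 1 by lia, sum_map_pow φ (by lia), if_pos dvd_rfl,
        show p - 1 - (p - 1 - l) = l by lia]
      ring
    · intro k hk hkl
      have hk := Finset.mem_range.1 hk
      rcases Nat.eq_zero_or_pos (l + k) with h0 | h0
      · rw [h0, sum_map_pow_zero, mul_zero]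
      rw [sum_map_pow φ h0.ne', if_neg, mul_zero]
      rintro ⟨c, hc⟩
      have hc2 : c < 2 := by
        by_contra hc2
        have : (p - 1) * 2 ≤ (p - 1) * c := Nat.mul_le_mul_left _ (by lia)
        lia
      interval_cases c <;> lia
    · intro h
      exact absurd (Finset.mem_range.2 (by lia)) h
  -- For `l = p - 1` both extreme terms `k = 0` and `k = p - 1` survive; the second cancels against
  -- `x^(p-1) ∑ t^(p-1)`.
  · obtain ⟨q, rfl⟩ : ∃ q, p = q + 2 := ⟨p - 2, by lia⟩
    rw [sum_map_pow φ (by lia), if_pos dvd_rfl, Finset.sum_range_succ', Finset.sum_range_succ,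
      Finset.sum_eq_zero]
    · rw [show q + 2 - 1 + (q + 1) = (q + 2 - 1) * 2 by lia, add_zero, sum_map_pow φ (by lia),
        sum_map_pow φ (by lia), if_pos (dvd_mul_right _ _), if_pos dvd_rfl]
      simp
    · intro k hk
      have hk := Finset.mem_range.1 hk
      rw [sum_map_pow φ (by lia), if_neg, mul_zero]
      rw [Nat.dvd_add_right dvd_rfl]
      exact fun h => (Nat.le_of_dvd (by lia) h).not_gt (by lia)

/-- Modulo the norm `y^p - x^(p-1) y` an exponent of `y` above `p - 1` drops by `p - 1`, and `t^p =
t` makes the interpolation sum drop in the same way. -/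
theorem dvd_interpolation [IsDomain R] [CharP R p] (x y : R) (l k c : ℕ)
    (h : k + l = c + (p - 1)) :
    y ^ p - x ^ (p - 1) * y ∣ x ^ k * y ^ l -
      ∑ t : ZMod p, φ t ^ l * ((x ^ (p - 1) - (y - φ t * x) ^ (p - 1)) * x ^ c) := by
  have hp := (Fact.out : p.Prime).two_le
  induction l using Nat.strong_induction_on generalizing k with
  | _ l ih =>
    rcases le_or_gt l (p - 1) with hl | hl
    · simp only [← mul_assoc]
      rw [← Finset.sum_mul, interpolation φ x y hl]
      have : x ^ k = x ^ (p - 1 - l) * x ^ c := by rw [← pow_add]; congr 1; lia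
      rw [this]
      exact ⟨0, by ring⟩
    · have h1 := ih (l - p + 1) (by lia) (k + (p - 1)) (by lia)
      have h2 : ∀ t : ZMod p, φ t ^ l = φ t ^ (l - p + 1) := by
        intro t
        have : t ^ l = t ^ (l - p + 1) := by
          conv_lhs => rw [show l = (l - p) + p by lia, pow_add, ZMod.pow_card, ← pow_succ]
        rw [← map_pow, this, map_pow]
      simp only [h2]
      have h3 : x ^ k * y ^ l = x ^ (k + (p - 1)) * y ^ (l - p + 1) +
          (y ^ p - x ^ (p - 1) * y) * (x ^ k * y ^ (l - p)) := by
        have : y ^ l = y ^ (l - p) * y ^ p := by rw [← pow_add]; congr 1; lia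
        rw [this]
        ring
      rw [h3, add_sub_right_comm]
      exact dvd_add h1 (dvd_mul_right _ _)

end PowerSums

/-! ### Invariants of large degree in one vector are transfers modulo a norm -/

section Transfer

variable {p : ℕ} [Fact p.Prime] {F : Type*} [Field F] [CharP F p] {m : ℕ}

/-- The product of the `y_i + s x_i` has degree at most `p - 1` in `s`, so summing over `s` picks
out minus its coefficient of `s^(p-1)`. Hence any `p - 1` factors `x_i` make a transfer. -/
theorem trP_prod_y (a : Multiset (Fin m)) (ha : a.card = p - 1) :
    trP p F m (a.map fun i => X (i, 1)).prod = -(a.map fun i => X (i, 0)).prod := by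
  set q : Fin m → Polynomial (MvPolynomial (Fin m × Fin 2) F) :=
    fun i => Polynomial.C (X (i, 0)) * Polynomial.X + Polynomial.C (X (i, 1)) with hq
  have hdeg : ∀ i, (q i).natDegree ≤ 1 := fun i => Polynomial.natDegree_linear_le
  have h1 : (a.map q).prod.natDegree ≤ p - 1 := by
    refine (Polynomial.natDegree_multiset_prod_le _).trans ?_
    rw [Multiset.map_map, ← ha]
    refine (Multiset.sum_le_card_nsmul _ 1 ?_).trans (by simp)
    intro n hn
    obtain ⟨i, _, rfl⟩ := Multiset.mem_map.1 hn
    exact hdeg i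
  have h2 := sum_eval_map ((C : F →+* MvPolynomial (Fin m × Fin 2) F).comp
    (ZMod.castHom (dvd_refl p) F)) (a.map q).prod h1
  have h3 : (a.map q).prod.coeff (p - 1) = (a.map fun i => X (i, 0)).prod := by
    have := Polynomial.coeff_multiset_prod_of_natDegree_le (a.map q) 1 (by
      intro n hn
      obtain ⟨i, _, rfl⟩ := Multiset.mem_map.1 hn
      exact hdeg i)
    rw [Multiset.card_map, mul_one, ha, Multiset.map_map] at this
    rw [this]
    congr 1
    refine Multiset.map_congr rfl fun i _ => ?_
    simp [hq]
  rw [h3] at h2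
  rw [← h2, trP_apply]
  refine Finset.sum_congr rfl fun s _ => ?_
  rw [map_multiset_prod, Polynomial.eval_multiset_prod, Multiset.map_map, Multiset.map_map]
  congr 1
  refine Multiset.map_congr rfl fun i _ => ?_
  rw [Function.comp_apply, Function.comp_apply, gsub_unip_y]
  simp [hq]
  ring

/-- Specialise the `i`-th vector to `(1, t)`. -/
noncomputable def spec {F : Type*} [Field F] {m : ℕ} (i : Fin m) (t : F) :
    MvPolynomial (Fin m × Fin 2) F →ₐ[F] MvPolynomial (Fin m × Fin 2) F :=
  MvPolynomial.aeval fun jk => if jk.1 = i then (if jk.2 = 0 then 1 else C t) else X jk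

theorem monomial_split {F : Type*} [Field F] (d : Fin m × Fin 2 →₀ ℕ) (r : F) (i : Fin m) :
    ∃ q : MvPolynomial (Fin m × Fin 2) F, (∀ t : F, spec i t q = q) ∧
      monomial d r = q * (X (i, 0) ^ d (i, 0) * X (i, 1) ^ d (i, 1)) := by
  refine ⟨C r * ∏ j ∈ Finset.univ.erase i, ∏ k, X (j, k) ^ d (j, k), fun t => ?_, ?_⟩
  · rw [map_mul, map_prod, algHom_C]
    congr 1
    refine Finset.prod_congr rfl fun j hj => ?_
    rw [map_prod]
    refine Finset.prod_congr rfl fun k _ => ?_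
    rw [map_pow, spec, aeval_X, if_neg (Finset.ne_of_mem_erase hj)]
  · rw [monomial_eq, Finsupp.prod_fintype _ _ (by simp), Fintype.prod_prod_type,
      ← Finset.mul_prod_erase _ _ (Finset.mem_univ i), Fin.prod_univ_two]
    ring

theorem spec_x {F : Type*} [Field F] (i : Fin m) (t : F) :
    spec i t (X (i, 0)) = (1 : MvPolynomial (Fin m × Fin 2) F) := by
  simp [spec]

theorem spec_y {F : Type*} [Field F] (i : Fin m) (t : F) :
    spec i t (X (i, 1)) = (C t : MvPolynomial (Fin m × Fin 2) F) := by
  simp [spec]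

theorem dvd_sub_spec {f : MvPolynomial (Fin m × Fin 2) F} {e : Fin m → ℕ} (hf : IsMulti f e)
    (i : Fin m) {c : ℕ} (hc : e i = c + (p - 1)) :
    nn p i ∣ f - ∑ t : ZMod p, spec i (ZMod.castHom (dvd_refl p) F t) f *
      ((X (i, 0) ^ (p - 1) - (X (i, 1) - C (ZMod.castHom (dvd_refl p) F t) * X (i, 0)) ^ (p - 1)) *
        X (i, 0) ^ c) := by
  induction hf using IsWeightedHomogeneous.induction_on with
  | zero => simp
  | add f g _ _ hf hg =>
    refine (dvd_add hf hg).trans (dvd_of_eq ?_)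
    simp only [map_add, add_mul, Finset.sum_add_distrib]
    ring
  | monomial d r hr =>
    obtain ⟨q, hq, h⟩ := monomial_split d r i
    have hd := weight_mdeg d i
    rw [hr, hc] at hd
    have := dvd_interpolation ((C : F →+* MvPolynomial (Fin m × Fin 2) F).comp
      (ZMod.castHom (dvd_refl p) F)) (X (i, 0)) (X (i, 1)) (d (i, 1)) (d (i, 0)) c hd.symm
    refine (dvd_mul_of_dvd_right this q).trans (dvd_of_eq ?_)
    rw [h, mul_sub, Finset.mul_sum]
    congr 1
    refine Finset.sum_congr rfl fun t _ => ?_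
    rw [map_mul, hq, map_mul, map_pow, map_pow, spec_x, spec_y]
    simp [mul_assoc]

theorem eq_sum_spec {f : MvPolynomial (Fin m × Fin 2) F} {e : Fin m → ℕ} (hf : IsMulti f e)
    (i : Fin m) (hc : e i = p - 1) :
    f = ∑ t : ZMod p, spec i (ZMod.castHom (dvd_refl p) F t) f *
      (X (i, 0) ^ (p - 1) -
        (X (i, 1) - C (ZMod.castHom (dvd_refl p) F t) * X (i, 0)) ^ (p - 1)) := by
  induction hf using IsWeightedHomogeneous.induction_on with
  | zero => simp
  | add f g _ _ hf hg =>
    conv_lhs => rw [hf, hg]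
    simp only [map_add, add_mul, Finset.sum_add_distrib]
  | monomial d r hr =>
    obtain ⟨q, hq, h⟩ := monomial_split d r i
    have hd := weight_mdeg d i
    rw [hr, hc] at hd
    have := interpolation ((C : F →+* MvPolynomial (Fin m × Fin 2) F).comp
      (ZMod.castHom (dvd_refl p) F)) (X (i, 0)) (X (i, 1)) (l := d (i, 1)) (by lia)
    rw [show p - 1 - d (i, 1) = d (i, 0) by lia] at this
    conv_lhs => rw [h, ← this, Finset.mul_sum]
    refine Finset.sum_congr rfl fun t _ => ?_
    rw [h, map_mul, hq, map_mul, map_pow, map_pow, spec_x, spec_y]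
    simp [mul_assoc]

/-- The specialisations of a `P`-invariant at the points `(1, t)` are translates of the one at `(1,
0)`. This turns an interpolation sum into a transfer. -/
theorem gsub_spec {f : MvPolynomial (Fin m × Fin 2) F} (hf : f ∈ unipInvariants p F m)
    (i : Fin m) (s : ZMod p) :
    gsub (unip s) (spec i 0 f) = spec i (ZMod.castHom (dvd_refl p) F (-s)) f := by
  have : ((gsub (unip s)).comp (spec i 0) :
      MvPolynomial (Fin m × Fin 2) F →ₐ[F] MvPolynomial (Fin m × Fin 2) F) =
      (spec i (ZMod.castHom (dvd_refl p) F (-s))).comp (gsub (unip s)) := by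
    ext ⟨j, k⟩ : 1
    rw [AlgHom.comp_apply, AlgHom.comp_apply]
    by_cases hj : j = i
    · subst hj
      fin_cases k
      · simp [gsub_unip_x, spec_x]
      · simp [gsub_unip_y, spec_x, spec_y]
    · have h1 : ∀ (k : Fin 2) (t : F), spec i t (X (j, k)) =
          (X (j, k) : MvPolynomial (Fin m × Fin 2) F) := by
        intro k t
        simp [spec, hj]
      fin_cases k
      · simp [gsub_unip_x, h1]
      · simp [gsub_unip_y, h1]
  have h2 := congrArg (fun ψ => ψ f) this
  simpa only [AlgHom.comp_apply, hf s] using h2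

theorem nn_ne_zero {F : Type*} [Field F] (i : Fin m) :
    (nn p i : MvPolynomial (Fin m × Fin 2) F) ≠ 0 := by
  intro h
  have := congrArg (MvPolynomial.eval fun ik : Fin m × Fin 2 => ((ik.2 : ℕ) : F)) h
  have hp := (Fact.out : p.Prime).two_le
  simp [nn, show p - 1 ≠ 0 by lia] at this

/-- Invariants of the unipotent subgroup whose degree in one vector is at least `p - 1` are
transfers up to multiples of the norm. -/
theorem exists_trP_add {f : MvPolynomial (Fin m × Fin 2) F} (hf : f ∈ unipInvariants p F m)
    {e : Fin m → ℕ} (he : IsMulti f e) (i : Fin m) (hi : p - 1 ≤ e i) :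
    ∃ h g, g ∈ unipInvariants p F m ∧ f = trP p F m h + nn p i * g := by
  obtain ⟨g, hg⟩ := dvd_sub_spec he i (c := e i - (p - 1)) (by lia)
  set h := spec i 0 f * ((X (i, 0) ^ (p - 1) - X (i, 1) ^ (p - 1)) * X (i, 0) ^ (e i - (p - 1)))
    with hh
  have h1 : ∑ t : ZMod p, spec i (ZMod.castHom (dvd_refl p) F t) f *
      ((X (i, 0) ^ (p - 1) - (X (i, 1) - C (ZMod.castHom (dvd_refl p) F t) * X (i, 0)) ^ (p - 1)) *
        X (i, 0) ^ (e i - (p - 1))) = trP p F m h := by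
    rw [trP_apply]
    -- The interpolation term at `t` is the image of `h` under `unip (-t)`.
    refine Fintype.sum_equiv (Equiv.neg _) _ _ fun t => ?_
    rw [hh, map_mul, gsub_spec hf]
    simp only [map_mul, map_sub, map_pow, gsub_unip_x, gsub_unip_y, Equiv.neg_apply, neg_neg,
      map_neg, neg_mul, ← sub_eq_add_neg]
  rw [h1] at hg
  refine ⟨h, g, fun s => ?_, by linear_combination hg⟩
  have h2 : nn p i * g ∈ unipInvariants p F m := by
    rw [← hg]
    exact sub_mem hf (trP_mem h)
  have h3 := h2 s
  rw [map_mul, nn_mem_unip i s] at h3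
  exact mul_left_cancel₀ (nn_ne_zero i) h3

theorem spec_eq_C {F : Type*} [Field F] {f : MvPolynomial (Fin m × Fin 2) F} {e : Fin m → ℕ}
    (he : IsMulti f e) (i : Fin m) (hi : ∀ j, j ≠ i → e j = 0) (t : F) :
    ∃ c, spec i t f = C c := by
  induction he using IsWeightedHomogeneous.induction_on with
  | zero => exact ⟨0, by simp⟩
  | add f g _ _ hf hg =>
    obtain ⟨a, ha⟩ := hf
    obtain ⟨b, hb⟩ := hg
    exact ⟨a + b, by rw [map_add, ha, hb, map_add]⟩
  | monomial d r hr =>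
    rw [spec, aeval_monomial, Finsupp.prod_fintype _ _ (by simp), Fintype.prod_prod_type,
      Finset.prod_eq_single i, Fin.prod_univ_two]
    · exact ⟨r * t ^ d (i, 1), by simp [algebraMap_eq]⟩
    · intro j _ hj
      have := weight_mdeg d j
      rw [hr, hi j hj] at this
      rw [Fin.prod_univ_two, show d (j, 0) = 0 by lia, show d (j, 1) = 0 by lia]
      simp
    · simp

/-- An invariant of degree at most `p - 1` in a single vector, of degree less than that,
is a power of `x_i`. -/
theorem eq_C_mul_pow {f : MvPolynomial (Fin m × Fin 2) F} (hf : f ∈ unipInvariants p F m)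
    {e : Fin m → ℕ} (he : IsMulti f e) (i : Fin m) (hi : ∀ j, j ≠ i → e j = 0)
    (hle : e i ≤ p - 1 - 1) : ∃ c, f = C c * X (i, 0) ^ e i := by
  have hp := (Fact.out : p.Prime).two_le
  obtain ⟨c, hc⟩ := spec_eq_C he i hi 0
  have h1 : ∀ t : ZMod p, spec i (ZMod.castHom (dvd_refl p) F t) f = C c := by
    intro t
    have := gsub_spec hf i (-t)
    rw [neg_neg, hc] at this
    rw [← this, algHom_C, algebraMap_eq]
  -- Padding with `x_i` reaches degree exactly `p - 1`, where interpolation holds without a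
  -- remainder. All interpolated values equal `c`, and the indicator forms sum to `x_i^(p-1)`.
  have h2 : IsMulti (X (i, 0) ^ (p - 1 - e i) * f) ((p - 1 - e i) • Pi.single i 1 + e) :=
    ((isMulti_X i 0).pow _).mul he
  have h3 := eq_sum_spec h2 i (by simp; lia)
  have h4 := interpolation ((C : F →+* MvPolynomial (Fin m × Fin 2) F).comp
      (ZMod.castHom (dvd_refl p) F)) (X (i, 0)) (X (i, 1)) (l := 0) (by lia)
  simp only [pow_zero, one_mul, mul_one, tsub_zero] at h4
  simp only [map_mul, map_pow, spec_x, one_pow, one_mul, h1] at h3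
  rw [← Finset.mul_sum] at h3
  refine ⟨c, mul_left_cancel₀ (pow_ne_zero (p - 1 - e i) (X_ne_zero (R := F) (i, (0 : Fin 2)))) ?_⟩
  rw [h3]
  refine (congrArg _ h4).trans ?_
  rw [mul_left_comm, ← pow_add, show p - 1 - e i + e i = p - 1 by lia]

end Transfer

/-! ### Graded components of products -/

section Component

variable {F : Type*} [Field F] {σ M : Type*} [AddCancelCommMonoid M]

theorem weightedHomogeneousComponent_mul {w : σ → M} {a : MvPolynomial σ F} {k : M}
    (ha : IsWeightedHomogeneous w a k) (n : M) (f : MvPolynomial σ F) :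
    weightedHomogeneousComponent w (k + n) (a * f) = a * weightedHomogeneousComponent w n f := by
  classical
  have : weightedHomogeneousComponent w (k + n) ∘ₗ LinearMap.mulLeft F a =
      LinearMap.mulLeft F a ∘ₗ weightedHomogeneousComponent w n := by
    apply MvPolynomial.linearMap_ext
    intro d
    ext1
    have hd := isWeightedHomogeneous_monomial w d (1 : F) rfl
    have hd' := ha.mul hd
    simp only [LinearMap.comp_apply, LinearMap.mulLeft_apply]
    rw [weightedHomogeneousComponent_of_mem (m := n) hd,
      weightedHomogeneousComponent_of_mem (m := k + n) hd']
    simp only [add_right_inj]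
    split_ifs <;> simp
  exact congrArg (fun φ => φ f) this

theorem weightedHomogeneousComponent_mul_eq_zero {w : σ → M} {a : MvPolynomial σ F} {k : M}
    (ha : IsWeightedHomogeneous w a k) {n : M} (hn : ∀ l, n ≠ k + l) (f : MvPolynomial σ F) :
    weightedHomogeneousComponent w n (a * f) = 0 := by
  classical
  have : weightedHomogeneousComponent w n ∘ₗ LinearMap.mulLeft F a = 0 := by
    apply MvPolynomial.linearMap_ext
    intro d
    ext1
    have hd := isWeightedHomogeneous_monomial w d (1 : F) rfl
    simp only [LinearMap.comp_apply, LinearMap.mulLeft_apply]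
    rw [weightedHomogeneousComponent_of_mem (m := n) (ha.mul hd), if_neg (hn _)]
    simp
  exact congrArg (fun φ => φ f) this

end Component

/-! ### Polarisation, Capelli's identity and the unipotent invariants -/

/-- The polarisation operator, which replaces the vector `j` by the vector `i`. -/
noncomputable def pol {F : Type*} [Field F] {m : ℕ} (i j : Fin m) :
    Derivation F (MvPolynomial (Fin m × Fin 2) F) (MvPolynomial (Fin m × Fin 2) F) :=
  (X (i, 0) : MvPolynomial (Fin m × Fin 2) F) • pderiv (j, 0) +
    (X (i, 1) : MvPolynomial (Fin m × Fin 2) F) • pderiv (j, 1)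

/-- Cayley's omega operator. -/
noncomputable def omega {F : Type*} [Field F] {m : ℕ} (i j : Fin m)
    (f : MvPolynomial (Fin m × Fin 2) F) : MvPolynomial (Fin m × Fin 2) F :=
  pderiv (i, 0) (pderiv (j, 1) f) - pderiv (i, 1) (pderiv (j, 0) f)

section Capelli

variable {F : Type*} [Field F] {m : ℕ}

theorem pol_apply (i j : Fin m) (f : MvPolynomial (Fin m × Fin 2) F) :
    pol i j f = X (i, 0) * pderiv (j, 0) f + X (i, 1) * pderiv (j, 1) f := rfl

theorem pol_self {f : MvPolynomial (Fin m × Fin 2) F} {e : Fin m → ℕ} (he : IsMulti f e)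
    (i : Fin m) : pol i i f = (e i : MvPolynomial (Fin m × Fin 2) F) * f := by
  classical
  have h := (IsWeightedHomogeneous.map_weight
    (Pi.evalAddMonoidHom (fun _ => ℕ) i) he).sum_weight_X_mul_pderiv
  rw [Fintype.sum_prod_type, Finset.sum_eq_single i, Fin.sum_univ_two] at h
  · simpa [mdeg, pol_apply] using h
  · intro j _ hj
    simp [mdeg, hj.symm]
  · simp

/-- Capelli's identity for two vectors, with Euler's formula applied to the diagonal polarisations.
When the scalar is invertible, `f` is recovered from a polynomial with degree moved from `j` to `i`
and one of total degree lower by two. -/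
theorem capelli {i j : Fin m} (hij : i ≠ j) {f : MvPolynomial (Fin m × Fin 2) F}
    {e : Fin m → ℕ} (he : IsMulti f e) :
    ((e j * (e i + 1) : ℕ) : F) • f = pol j i (pol i j f) + uu i j * omega i j f := by
  have h1 : pol i i (pol j j f) = ((e j * e i : ℕ) : MvPolynomial (Fin m × Fin 2) F) * f := by
    rw [pol_self he j, Derivation.leibniz, Derivation.map_natCast, pol_self he i]
    simp [mul_assoc]
  have h2 := pol_self he j
  have h3 : ((e j * (e i + 1) : ℕ) : F) • f = pol i i (pol j j f) + pol j j f := by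
    rw [h1, h2, smul_eq_C_mul]
    simp
    ring
  rw [h3]
  have n1 : (i, (0 : Fin 2)) ≠ (j, 0) := by simpa using hij
  have n2 : (i, (1 : Fin 2)) ≠ (j, 1) := by simpa using hij
  simp only [pol_apply, omega, uu, Derivation.leibniz, map_add, smul_eq_mul, pderiv_X,
    Pi.single_apply, Prod.mk.injEq, hij.symm, zero_ne_one, one_ne_zero, and_false,
    and_true, if_false, if_true]
  ring

theorem isMulti_pol {i j : Fin m} {f : MvPolynomial (Fin m × Fin 2) F} {n : Fin m → ℕ}
    (he : IsMulti f (n + Pi.single j 1)) : IsMulti (pol i j f) (n + Pi.single i 1) := by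
  rw [pol_apply, add_comm n]
  exact ((isMulti_X i 0).mul (IsWeightedHomogeneous.pderiv he rfl)).add
    ((isMulti_X i 1).mul (IsWeightedHomogeneous.pderiv he rfl))

theorem isMulti_omega {i j : Fin m} {f : MvPolynomial (Fin m × Fin 2) F} {n : Fin m → ℕ}
    (he : IsMulti f (n + Pi.single i 1 + Pi.single j 1)) : IsMulti (omega i j f) n :=
  IsWeightedHomogeneous.sub
    (IsWeightedHomogeneous.pderiv (n := n + Pi.single i 1)
      (IsWeightedHomogeneous.pderiv he rfl) rfl)
    (IsWeightedHomogeneous.pderiv (n := n + Pi.single i 1)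
      (IsWeightedHomogeneous.pderiv he rfl) rfl)

theorem pderiv_eq_zero {f : MvPolynomial (Fin m × Fin 2) F} {e : Fin m → ℕ} (he : IsMulti f e)
    {i : Fin m} (hi : e i = 0) (k : Fin 2) : pderiv (i, k) f = 0 := by
  induction he using IsWeightedHomogeneous.induction_on with
  | zero => simp
  | add f g _ _ hf hg => rw [map_add, hf, hg, add_zero]
  | monomial d r hr =>
    have := weight_mdeg d i
    rw [hr, hi] at this
    have h0 : d (i, k) = 0 := by fin_cases k <;> (simp; lia)
    rw [pderiv_monomial, h0]
    simp

theorem omega_eq_zero {f : MvPolynomial (Fin m × Fin 2) F} {n : Fin m → ℕ} {i j : Fin m}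
    (he : IsMulti f (n + Pi.single j 1)) (hi : n i = 0) : omega i j f = 0 := by
  rw [omega, pderiv_eq_zero (e := n) (IsWeightedHomogeneous.pderiv he rfl) hi,
    pderiv_eq_zero (e := n) (IsWeightedHomogeneous.pderiv he rfl) hi, sub_zero]

variable {p : ℕ} [CharP F p]

theorem gsub_C (g : Matrix.SpecialLinearGroup (Fin 2) (ZMod p)) (c : F) :
    gsub g (C c : MvPolynomial (Fin m × Fin 2) F) = C c := by
  rw [algHom_C, algebraMap_eq]

variable [Fact p.Prime]

theorem pderiv_y_gsub (s : ZMod p) (i : Fin m) (f : MvPolynomial (Fin m × Fin 2) F) :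
    pderiv (i, 1) (gsub (unip s) f) = gsub (unip s) (pderiv (i, 1) f) := by
  classical
  induction f using MvPolynomial.induction_on with
  | C a => simp only [gsub_C, pderiv_C, map_zero]
  | add f g hf hg => simp only [map_add, hf, hg]
  | mul_X f jk hf =>
    obtain ⟨j, k⟩ := jk
    simp only [map_mul, Derivation.leibniz, smul_eq_mul, map_add, hf]
    congr 2
    fin_cases k
    · simp [gsub_unip_x, pderiv_X]
    · by_cases h : j = i
      · subst h
        simp [gsub_unip_y, pderiv_X]
      · simp [gsub_unip_y, pderiv_X, h]

theorem pderiv_x_gsub (s : ZMod p) (i : Fin m) (f : MvPolynomial (Fin m × Fin 2) F) :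
    pderiv (i, 0) (gsub (unip s) f) = gsub (unip s) (pderiv (i, 0) f) +
      C (ZMod.castHom (dvd_refl p) F s) * gsub (unip s) (pderiv (i, 1) f) := by
  classical
  induction f using MvPolynomial.induction_on with
  | C a => simp only [gsub_C, pderiv_C, map_zero, mul_zero, add_zero]
  | add f g hf hg =>
    simp only [map_add, hf, hg]
    ring
  | mul_X f jk hf =>
    obtain ⟨j, k⟩ := jk
    simp only [map_mul, Derivation.leibniz, smul_eq_mul, map_add, hf]
    have : pderiv (i, 0) (gsub (unip s) (X (j, k) : MvPolynomial (Fin m × Fin 2) F)) =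
        gsub (unip s) (pderiv (i, 0) (X (j, k))) +
        C (ZMod.castHom (dvd_refl p) F s) * gsub (unip s) (pderiv (i, 1) (X (j, k))) := by
      by_cases h : j = i
      · subst h
        fin_cases k
        · simp [gsub_unip_x, pderiv_X]
        · simp [gsub_unip_y, pderiv_X]
      · fin_cases k
        · simp [gsub_unip_x, pderiv_X, h]
        · simp [gsub_unip_y, pderiv_X, h]
    rw [this]
    ring

theorem pol_gsub (s : ZMod p) (i j : Fin m) (f : MvPolynomial (Fin m × Fin 2) F) :
    pol i j (gsub (unip s) f) = gsub (unip s) (pol i j f) := by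
  simp only [pol_apply, map_add, map_mul, pderiv_x_gsub, pderiv_y_gsub, gsub_unip_x, gsub_unip_y]
  ring

theorem omega_gsub (s : ZMod p) (i j : Fin m) (f : MvPolynomial (Fin m × Fin 2) F) :
    omega i j (gsub (unip s) f) = gsub (unip s) (omega i j f) := by
  simp only [omega, map_sub, pderiv_y_gsub, pderiv_x_gsub, map_add, Derivation.leibniz,
    pderiv_C, smul_eq_mul, mul_zero, add_zero]
  ring

theorem pol_mem_unip {f : MvPolynomial (Fin m × Fin 2) F} (hf : f ∈ unipInvariants p F m)
    (i j : Fin m) : pol i j f ∈ unipInvariants p F m := fun s => by rw [← pol_gsub, hf s]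

theorem omega_mem_unip {f : MvPolynomial (Fin m × Fin 2) F} (hf : f ∈ unipInvariants p F m)
    (i j : Fin m) : omega i j f ∈ unipInvariants p F m := fun s => by rw [← omega_gsub, hf s]

theorem pol_trP (i j : Fin m) (f : MvPolynomial (Fin m × Fin 2) F) :
    pol i j (trP p F m f) = trP p F m (pol i j f) := by
  simp only [trP_apply, map_sum, pol_gsub]

/-- The algebra generated by the `x_i`, the `u_ij` and the norms. -/
noncomputable def xun (p : ℕ) (F : Type*) [Field F] (m : ℕ) :
    Subalgebra F (MvPolynomial (Fin m × Fin 2) F) :=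
  Algebra.adjoin F ((Set.range fun i : Fin m => X (i, 0)) ∪
    (Set.range fun ij : Fin m × Fin m => uu ij.1 ij.2) ∪ Set.range (nn p))

theorem X_mem_xun (i : Fin m) : X (i, 0) ∈ xun p F m :=
  Algebra.subset_adjoin (Or.inl (Or.inl ⟨i, rfl⟩))

theorem uu_mem_xun (i j : Fin m) : uu i j ∈ xun p F m :=
  Algebra.subset_adjoin (Or.inl (Or.inr ⟨(i, j), rfl⟩))

theorem nn_mem_xun (i : Fin m) : nn p i ∈ xun p F m :=
  Algebra.subset_adjoin (Or.inr ⟨i, rfl⟩)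

theorem xun_le_unip : xun p F m ≤ unipInvariants p F m := by
  refine Algebra.adjoin_le ?_
  rintro _ ((⟨i, rfl⟩ | ⟨ij, rfl⟩) | ⟨i, rfl⟩)
  · exact X_mem_unip i
  · exact invariants_le_unip (uu_mem _ _)
  · exact nn_mem_unip i

/-- A derivation need only be checked on generators. The one that needs characteristic `p` is the
norm, whose polarisation is `x_k^(p-2) u_ik`. -/
theorem pol_mem_xun {f : MvPolynomial (Fin m × Fin 2) F} (hf : f ∈ xun p F m) (i j : Fin m) :
    pol i j f ∈ xun p F m := by
  classical
  induction hf using Algebra.adjoin_induction with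
  | algebraMap r => simp
  | add f g _ _ hf hg => rw [map_add]; exact add_mem hf hg
  | mul f g hf' hg' hf hg =>
    rw [Derivation.leibniz]
    exact add_mem (mul_mem hf' hg) (mul_mem hg' hf)
  | mem f hf =>
    have key : ∀ (P : Prop) [Decidable P] (a : MvPolynomial (Fin m × Fin 2) F),
        a ∈ xun p F m → (if P then a else 0) ∈ xun p F m := by
      intro P _ a ha
      split_ifs
      exacts [ha, zero_mem _]
    obtain ((⟨k, rfl⟩ | ⟨⟨k, l⟩, rfl⟩) | ⟨k, rfl⟩) := hf
    · have : pol i j (X (k, 0) : MvPolynomial (Fin m × Fin 2) F) =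
          if k = j then X (i, 0) else 0 := by
        simp [pol_apply, pderiv_X, Pi.single_apply]
      simp only [this]
      exact key _ _ (X_mem_xun i)
    · have : pol i j (uu k l : MvPolynomial (Fin m × Fin 2) F) =
          (if k = j then uu i l else 0) + if l = j then uu k i else 0 := by
        simp only [pol_apply, uu, map_sub, Derivation.leibniz, smul_eq_mul, pderiv_X,
          Pi.single_apply, Prod.mk.injEq, zero_ne_one, one_ne_zero, and_false, and_true, if_false]
        split_ifs <;> ring
      simp only [this]
      exact add_mem (key _ _ (uu_mem_xun _ _)) (key _ _ (uu_mem_xun _ _))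
    · have : pol i j (nn p k : MvPolynomial (Fin m × Fin 2) F) =
          if k = j then X (k, 0) ^ (p - 2) * uu i k else 0 := by
        obtain ⟨q, rfl⟩ : ∃ q, p = q + 2 := ⟨p - 2, by
          have := (Fact.out : p.Prime).two_le
          lia⟩
        have hq : ((q + 2 : ℕ) : MvPolynomial (Fin m × Fin 2) F) = 0 := CharP.cast_eq_zero _ _
        push_cast at hq
        rw [pol_apply, nn]
        simp only [uu, map_sub, Derivation.leibniz, Derivation.leibniz_pow,
          smul_eq_mul, pderiv_X,
          Pi.single_apply, Prod.mk.injEq, zero_ne_one, one_ne_zero, and_false, and_true, if_false,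
          show q + 2 - 1 = q + 1 from rfl, show q + 1 - 1 = q from rfl,
          show q + 2 - 2 = q from rfl, nsmul_eq_mul]
        push_cast
        split_ifs
        · linear_combination
            (X (i, 1) * X (k, 1) ^ (q + 1) - X (i, 0) * X (k, 1) * X (k, 0) ^ q) * hq
        · ring
      simp only [this]
      exact key _ _ (mul_mem (pow_mem (X_mem_xun _) _) (uu_mem_xun _ _))

theorem pol_mem_sup {f : MvPolynomial (Fin m × Fin 2) F}
    (hf : f ∈ (xun p F m).toSubmodule ⊔ LinearMap.range (trP p F m)) (i j : Fin m) :
    pol i j f ∈ (xun p F m).toSubmodule ⊔ LinearMap.range (trP p F m) := by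
  obtain ⟨a, ha, _, ⟨h, rfl⟩, rfl⟩ := Submodule.mem_sup.1 hf
  rw [map_add, pol_trP]
  exact Submodule.add_mem_sup (pol_mem_xun ha i j) ⟨_, rfl⟩

theorem mul_mem_sup {f k : MvPolynomial (Fin m × Fin 2) F}
    (hf : f ∈ (xun p F m).toSubmodule ⊔ LinearMap.range (trP p F m)) (hk : k ∈ xun p F m) :
    k * f ∈ (xun p F m).toSubmodule ⊔ LinearMap.range (trP p F m) := by
  obtain ⟨a, ha, _, ⟨h, rfl⟩, rfl⟩ := Submodule.mem_sup.1 hf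
  rw [mul_add, ← trP_mul (xun_le_unip hk)]
  exact Submodule.add_mem_sup ((xun p F m).mul_mem hk ha) ⟨_, rfl⟩

theorem exists_add_single {m : ℕ} {e : Fin m → ℕ} {j : Fin m} (h : e j ≠ 0) :
    ∃ e' : Fin m → ℕ, e = e' + Pi.single j 1 :=
  ⟨e - Pi.single j 1, (tsub_add_cancel_of_le fun k => by
    rcases eq_or_ne k j with rfl | hk
    · rw [Pi.single_eq_same]
      exact Nat.pos_of_ne_zero h
    · simp [hk]).symm⟩

theorem isMulti_trP {f : MvPolynomial (Fin m × Fin 2) F} {e : Fin m → ℕ} (hf : IsMulti f e) :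
    IsMulti (trP p F m f) e := by
  rw [trP_apply]
  exact IsWeightedHomogeneous.sum _ _ _ fun s _ => IsMulti.gsub hf _

/-- Taking the component of multidegree `e` keeps the decomposition and makes the cofactor of the
norm multihomogeneous, as the induction on degree requires. -/
theorem exists_trP_add_multi {f : MvPolynomial (Fin m × Fin 2) F} (hf : f ∈ unipInvariants p F m)
    {e : Fin m → ℕ} (he : IsMulti f e) (i : Fin m) (hi : p - 1 ≤ e i) :
    ∃ h g, g ∈ unipInvariants p F m ∧ f = trP p F m h + nn p i * g ∧
      (g = 0 ∨ ∃ e', e = p • Pi.single i 1 + e' ∧ IsMulti g e') := by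
  obtain ⟨h, g, hg, h1⟩ := exists_trP_add hf he i hi
  have h2 := congrArg (weightedHomogeneousComponent mdeg e) h1
  rw [he.weightedHomogeneousComponent_same, map_add, weightedHomogeneousComponent_map (trP p F m)
    (fun _ _ hf => isMulti_trP hf)] at h2
  by_cases hl : ∃ l, e = p • Pi.single i 1 + l
  · obtain ⟨e', rfl⟩ := hl
    rw [weightedHomogeneousComponent_mul (isMulti_nn i)] at h2
    exact ⟨_, _, component_mem_unip hg e', h2, Or.inr ⟨e', rfl,
      weightedHomogeneousComponent_isWeightedHomogeneous _ _⟩⟩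
  · push Not at hl
    rw [weightedHomogeneousComponent_mul_eq_zero (isMulti_nn i) hl] at h2
    exact ⟨_, 0, zero_mem _, by rw [mul_zero]; exact h2, Or.inl rfl⟩

/-- Induction on the total degree, then on the degree outside a fixed vector `i`. A degree of at
least `p - 1` in some vector is handled by interpolation; otherwise Capelli's identity moves degree
into the vector `i`. -/
theorem unip_mem_sup_of_isMulti (n : ℕ) : ∀ (e : Fin m → ℕ), ∑ i, e i = n →
    ∀ f : MvPolynomial (Fin m × Fin 2) F, f ∈ unipInvariants p F m → IsMulti f e →
      f ∈ (xun p F m).toSubmodule ⊔ LinearMap.range (trP p F m) := by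
  have hp := (Fact.out : p.Prime).two_le
  induction n using Nat.strong_induction_on with
  | _ n ih =>
  rcases isEmpty_or_nonempty (Fin m) with hm | ⟨⟨i⟩⟩
  · intro e _ f _ _
    rw [eq_C_of_isEmpty f]
    exact Submodule.mem_sup_left ((xun p F m).algebraMap_mem _)
  suffices H : ∀ r : ℕ, ∀ e : Fin m → ℕ, ∑ j ∈ Finset.univ.erase i, e j = r → ∑ i, e i = n →
      ∀ f : MvPolynomial (Fin m × Fin 2) F, f ∈ unipInvariants p F m → IsMulti f e →
      f ∈ (xun p F m).toSubmodule ⊔ LinearMap.range (trP p F m) from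
    fun e he => H _ e rfl he
  intro r
  induction r with
  | zero =>
    intro e hr hn f hf he
    have hz : ∀ j, j ≠ i → e j = 0 := fun j hj =>
      (Finset.sum_eq_zero_iff.1 hr) j (Finset.mem_erase.2 ⟨hj, Finset.mem_univ _⟩)
    rcases le_or_gt (p - 1) (e i) with hi | hi
    · obtain ⟨h, g, hg, rfl, h0⟩ := exists_trP_add_multi hf he i hi
      refine add_mem (Submodule.mem_sup_right ⟨h, rfl⟩) (mul_mem_sup ?_ (nn_mem_xun i))
      rcases h0 with rfl | ⟨e', rfl, he'⟩
      · exact zero_mem _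
      · refine ih _ ?_ e' rfl g hg he'
        rw [← hn]
        simp [Finset.sum_add_distrib, ← Finset.mul_sum]
        lia
    · obtain ⟨c, hc⟩ := eq_C_mul_pow hf he i hz (by lia)
      rw [hc]
      exact Submodule.mem_sup_left ((xun p F m).mul_mem ((xun p F m).algebraMap_mem _)
        (pow_mem (X_mem_xun i) _))
  | succ r ihr =>
    intro e hr hn f hf he
    by_cases hl : ∃ l, p - 1 ≤ e l
    · obtain ⟨l, hl⟩ := hl
      obtain ⟨h, g, hg, rfl, h0⟩ := exists_trP_add_multi hf he l hl
      refine add_mem (Submodule.mem_sup_right ⟨h, rfl⟩) (mul_mem_sup ?_ (nn_mem_xun l))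
      rcases h0 with rfl | ⟨e', rfl, he'⟩
      · exact zero_mem _
      · refine ih _ ?_ e' rfl g hg he'
        rw [← hn]
        simp [Finset.sum_add_distrib, ← Finset.mul_sum]
        lia
    · push Not at hl
      obtain ⟨j, hj, hj0⟩ : ∃ j ∈ Finset.univ.erase i, e j ≠ 0 := by
        by_contra! hc
        rw [Finset.sum_eq_zero hc] at hr
        lia
      have hji := Finset.ne_of_mem_erase hj
      obtain ⟨e', rfl⟩ : ∃ e', e = e' + Pi.single j 1 := exists_add_single hj0
      have hc := capelli hji.symm he
      have hli := hl i
      have hlj := hl j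
      simp only [Pi.add_apply, Pi.single_eq_same, Pi.single_eq_of_ne hji.symm] at hc hli hlj
      -- All degrees are below `p - 1`, so even the factor `e_i + 1` stays below `p`.
      have hne : (((e' j + 1) * (e' i + 0 + 1) : ℕ) : F) ≠ 0 := by
        rw [Ne, CharP.cast_eq_zero_iff F p, (Fact.out : p.Prime).dvd_mul]
        rintro (h | h)
        · exact (Nat.le_of_dvd (by lia) h).not_gt (by lia)
        · exact (Nat.le_of_dvd (by lia) h).not_gt (by lia)
      have hsum : ∑ k, e' k + 1 = n := by
        rw [← hn]
        simp [Finset.sum_add_distrib]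
      suffices H : pol j i (pol i j f) + uu i j * omega i j f ∈
          (xun p F m).toSubmodule ⊔ LinearMap.range (trP p F m) from
        (Submodule.smul_mem_iff _ hne).1 (hc ▸ H)
      refine add_mem (pol_mem_sup ?_ _ _) (mul_mem_sup ?_ (uu_mem_xun _ _))
      · refine ihr (e' + Pi.single i 1) ?_ ?_ _ (pol_mem_unip hf _ _) (isMulti_pol he)
        · simp only [Pi.add_apply, Finset.sum_add_distrib] at hr ⊢
          rw [Finset.sum_pi_single', if_pos hj] at hr
          rw [Finset.sum_pi_single']
          simp
          lia
        · rw [← hsum]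
          simp [Finset.sum_add_distrib]
      · rcases Nat.eq_zero_or_pos (e' i) with h0 | h0
        · rw [omega_eq_zero he h0]
          exact zero_mem _
        · obtain ⟨e'', rfl⟩ : ∃ e'', e' = e'' + Pi.single i 1 :=
            exists_add_single h0.ne'
          refine ih _ ?_ e'' rfl _ (omega_mem_unip hf _ _) (isMulti_omega he)
          rw [← hsum]
          simp [Finset.sum_add_distrib]

/-- The invariants of the unipotent subgroup are generated by the `x_i`, the `u_ij` and the norms
up to transfers. -/
theorem unip_mem_sup {f : MvPolynomial (Fin m × Fin 2) F} (hf : f ∈ unipInvariants p F m) :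
    f ∈ (xun p F m).toSubmodule ⊔ LinearMap.range (trP p F m) :=
  mem_of_components (w := mdeg) _ f fun e => unip_mem_sup_of_isMulti _ e rfl _
    (component_mem_unip hf e) (weightedHomogeneousComponent_isWeightedHomogeneous _ _)

end Capelli

/-! ### Dickson invariants, averaging over the torus, and generation up to transfers -/

theorem exists_multiset_add {α : Type*} (b : Multiset α) {n k : ℕ} (h : b.card = n + k) :
    ∃ b₁ b₂, b = b₁ + b₂ ∧ b₁.card = n ∧ b₂.card = k := by
  induction b using Quotient.inductionOn with
  | h l =>
    have hl : l.length = n + k := h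
    refine ⟨(l.take n : Multiset α), (l.drop n : Multiset α), ?_, ?_, ?_⟩
    · rw [Multiset.coe_add, List.take_append_drop]; rfl
    · simp [hl]
    · simp [hl]

/-- Products of norms. -/
noncomputable def nnProd {F : Type*} [Field F] {m : ℕ} (p : ℕ) (b : Multiset (Fin m)) :
    MvPolynomial (Fin m × Fin 2) F := (b.map (nn p)).prod

/-- Products of the coordinates `x_i` or `y_i`. -/
noncomputable def xyProd {F : Type*} [Field F] {m : ℕ} (k : Fin 2) (a : Multiset (Fin m)) :
    MvPolynomial (Fin m × Fin 2) F := (a.map fun i => X (i, k)).prod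

/-- The polarised second Dickson invariants. -/
noncomputable def dd (p : ℕ) [Fact p.Prime] (F : Type*) [Field F] [CharP F p] {m : ℕ}
    (b : Multiset (Fin m)) : MvPolynomial (Fin m × Fin 2) F := -trRel p F m (nnProd p b)

section

variable {p : ℕ} [Fact p.Prime] {F : Type*} [Field F] [CharP F p] {m : ℕ}

theorem nnProd_add (b c : Multiset (Fin m)) :
    (nnProd p (b + c) : MvPolynomial (Fin m × Fin 2) F) = nnProd p b * nnProd p c := by
  simp [nnProd]

theorem xyProd_add (k : Fin 2) (b c : Multiset (Fin m)) :
    (xyProd k (b + c) : MvPolynomial (Fin m × Fin 2) F) = xyProd k b * xyProd k c := by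
  simp [xyProd]

theorem nnProd_mem_unip (b : Multiset (Fin m)) : nnProd p b ∈ unipInvariants p F m := by
  refine multiset_prod_mem _ fun x hx => ?_
  obtain ⟨i, _, rfl⟩ := Multiset.mem_map.1 hx
  exact nn_mem_unip i

theorem xProd_mem_unip (a : Multiset (Fin m)) : xyProd 0 a ∈ unipInvariants p F m := by
  refine multiset_prod_mem _ fun x hx => ?_
  obtain ⟨i, _, rfl⟩ := Multiset.mem_map.1 hx
  exact X_mem_unip i

theorem trP_yProd {a : Multiset (Fin m)} (ha : a.card = p - 1) :
    trP p F m (xyProd 1 a) = -xyProd 0 a := trP_prod_y a ha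

theorem gsub_diag_x {c : ZMod p} (hc : c ≠ 0) (i : Fin m) :
    gsub (rowRep (c, 0)) (X (i, 0) : MvPolynomial (Fin m × Fin 2) F) =
      C (ZMod.castHom (dvd_refl p) F c) * X (i, 0) := by
  rw [gsub_X, rowRep]
  simp [hc]

theorem gsub_diag_y {c : ZMod p} (hc : c ≠ 0) (i : Fin m) :
    gsub (rowRep (c, 0)) (X (i, 1) : MvPolynomial (Fin m × Fin 2) F) =
      C (ZMod.castHom (dvd_refl p) F c⁻¹) * X (i, 1) := by
  rw [gsub_X, rowRep]
  simp [hc]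

theorem gsub_diag_nn {c : ZMod p} (hc : c ≠ 0) (i : Fin m) :
    gsub (rowRep (c, 0)) (nn p i : MvPolynomial (Fin m × Fin 2) F) =
      C (ZMod.castHom (dvd_refl p) F c⁻¹) * nn p i := by
  have h : (ZMod.castHom (dvd_refl p) F c) ^ (p - 1) = 1 := by
    rw [← map_pow, ZMod.pow_card_sub_one_eq_one hc, map_one]
  simp only [nn, map_sub, map_mul, map_pow, gsub_diag_x hc, gsub_diag_y hc, mul_pow, ← C_pow,
    castHom_pow, h, C_1]
  ring

theorem gsub_diag_nnProd {c : ZMod p} (hc : c ≠ 0) (b : Multiset (Fin m)) :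
    gsub (rowRep (c, 0)) (nnProd p b : MvPolynomial (Fin m × Fin 2) F) =
      C (ZMod.castHom (dvd_refl p) F c⁻¹) ^ b.card * nnProd p b := by
  rw [nnProd, map_multiset_prod, Multiset.map_map]
  simp only [Function.comp_def, gsub_diag_nn hc]
  rw [Multiset.prod_map_mul]
  simp

theorem gsub_diag_xProd {c : ZMod p} (hc : c ≠ 0) (b : Multiset (Fin m)) :
    gsub (rowRep (c, 0)) (xyProd 0 b : MvPolynomial (Fin m × Fin 2) F) =
      C (ZMod.castHom (dvd_refl p) F c) ^ b.card * xyProd 0 b := by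
  rw [xyProd, map_multiset_prod, Multiset.map_map]
  simp only [Function.comp_def, gsub_diag_x hc]
  rw [Multiset.prod_map_mul]
  simp

theorem dd_mem (b : Multiset (Fin m)) : dd p F b ∈ vectorInvariants p F m :=
  neg_mem (trRel_mem (nnProd_mem_unip b))

/-- In the Bruhat form of the relative transfer the torus fixes a product of `p - 1` norms, so its
part is `p - 1 = -1` times that product. The sign in `dd` makes the leading coefficient `1`. -/
theorem exists_dd_eq {b : Multiset (Fin m)} (hb : b.card = p - 1) :
    ∃ h, dd p F b = nnProd p b + trP p F m h := by
  have h1 : ∀ a ∈ Finset.univ.erase (0 : ZMod p), gsub (rowRep (a, 0))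
      (nnProd p b : MvPolynomial (Fin m × Fin 2) F) = nnProd p b := by
    intro a ha
    have ha := Finset.ne_of_mem_erase ha
    rw [gsub_diag_nnProd ha, hb, ← C_pow, ← map_pow, inv_pow, ZMod.pow_card_sub_one_eq_one ha]
    simp
  refine ⟨-∑ b' ∈ Finset.univ.erase (0 : ZMod p), gsub (rowRep (0, b')) (nnProd p b), ?_⟩
  rw [dd, trRel_eq, Finset.sum_congr rfl h1, map_neg, Finset.sum_const,
    Finset.card_erase_of_mem (Finset.mem_univ _), Finset.card_univ, ZMod.card, nsmul_eq_mul,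
    Nat.cast_sub (Fact.out : p.Prime).one_le]
  simp
  ring

/-- The algebra generated by the invariants `u_ij`, and by the polarised Dickson invariants. -/
noncomputable def uld (p : ℕ) [Fact p.Prime] (F : Type*) [Field F] [CharP F p] (m : ℕ) :
    Subalgebra F (MvPolynomial (Fin m × Fin 2) F) :=
  Algebra.adjoin F ((Set.range fun ij : Fin m × Fin m => uu ij.1 ij.2) ∪
    (Set.range fun ij : Fin m × Fin m => ll p ij.1 ij.2) ∪
    (dd p F '' {b : Multiset (Fin m) | b.card = p - 1}))

theorem uu_mem_uld (i j : Fin m) : uu i j ∈ uld p F m :=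
  Algebra.subset_adjoin (Or.inl (Or.inl ⟨(i, j), rfl⟩))

theorem ll_mem_uld (i j : Fin m) : ll p i j ∈ uld p F m :=
  Algebra.subset_adjoin (Or.inl (Or.inr ⟨(i, j), rfl⟩))

theorem dd_mem_uld {b : Multiset (Fin m)} (hb : b.card = p - 1) : dd p F b ∈ uld p F m :=
  Algebra.subset_adjoin (Or.inr ⟨b, hb, rfl⟩)

theorem uld_le : uld p F m ≤ vectorInvariants p F m := by
  refine Algebra.adjoin_le ?_
  rintro _ ((⟨ij, rfl⟩ | ⟨ij, rfl⟩) | ⟨b, _, rfl⟩)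
  · exact uu_mem _ _
  · exact ll_mem _ _
  · exact dd_mem _

theorem trP_mul_mem_range (h : MvPolynomial (Fin m × Fin 2) F)
    {q : MvPolynomial (Fin m × Fin 2) F} (hq : q ∈ unipInvariants p F m) :
    trP p F m h * q ∈ LinearMap.range (trP p F m) :=
  ⟨q * h, by rw [trP_mul hq, mul_comm]⟩

/-- Transfers form an ideal of the `P`-invariants, so adding them to a subalgebra of `P`-invariants
gives something closed under products. -/
theorem mul_mem_uld_sup {f g : MvPolynomial (Fin m × Fin 2) F}
    (hf : f ∈ (uld p F m).toSubmodule ⊔ LinearMap.range (trP p F m))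
    (hg : g ∈ (uld p F m).toSubmodule ⊔ LinearMap.range (trP p F m)) :
    f * g ∈ (uld p F m).toSubmodule ⊔ LinearMap.range (trP p F m) := by
  obtain ⟨a, ha, _, ⟨h, rfl⟩, rfl⟩ := Submodule.mem_sup.1 hf
  obtain ⟨b, hb, _, ⟨k, rfl⟩, rfl⟩ := Submodule.mem_sup.1 hg
  have ha' := invariants_le_unip (uld_le ha)
  have hb' := invariants_le_unip (uld_le hb)
  have : (a + trP p F m h) * (b + trP p F m k) =
      a * b + (trP p F m k * a + trP p F m h * (b + trP p F m k)) := by ring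
  rw [this]
  exact Submodule.add_mem_sup ((uld p F m).mul_mem ha hb)
    (add_mem (trP_mul_mem_range _ ha') (trP_mul_mem_range _ (add_mem hb' (trP_mem _))))

/-- The correction `-x_j^(p-1) u_ij` from `ll_eq` is a transfer because `-x_j^(p-1)` is the transfer
of `y_j^(p-1)`. -/
theorem x_mul_nn_eq (i j : Fin m) : (X (i, 0) * nn p j : MvPolynomial (Fin m × Fin 2) F) =
    ll p i j + trP p F m (uu i j * X (j, 1) ^ (p - 1)) := by
  have := trP_yProd (F := F) (a := Multiset.replicate (p - 1) j) (by simp)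
  simp only [xyProd, Multiset.map_replicate, Multiset.prod_replicate] at this
  rw [trP_mul (invariants_le_unip (uu_mem i j)), this, ll_eq]
  ring

theorem x_mul_nn_mem (i j : Fin m) : (X (i, 0) * nn p j : MvPolynomial (Fin m × Fin 2) F) ∈
    (uld p F m).toSubmodule ⊔ LinearMap.range (trP p F m) := by
  rw [x_mul_nn_eq]
  exact Submodule.add_mem_sup (ll_mem_uld i j) ⟨_, rfl⟩

theorem xProd_mul_nnProd_mem (a : Multiset (Fin m)) : ∀ b : Multiset (Fin m), b.card = a.card →
    (xyProd 0 a * nnProd p b : MvPolynomial (Fin m × Fin 2) F) ∈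
      (uld p F m).toSubmodule ⊔ LinearMap.range (trP p F m) := by
  induction a using Multiset.induction_on with
  | empty =>
    intro b hb
    rw [Multiset.card_zero, Multiset.card_eq_zero] at hb
    subst hb
    simp only [xyProd, nnProd, Multiset.map_zero, Multiset.prod_zero, mul_one]
    exact Submodule.mem_sup_left (one_mem (uld p F m))
  | cons i a ih =>
    intro b hb
    rw [Multiset.card_cons] at hb
    obtain ⟨j, b, rfl⟩ := Multiset.card_pos_iff_exists_mem.1 (by lia : 0 < b.card) |>.imp
      fun j hj => Multiset.exists_cons_of_mem hj
    have := mul_mem_uld_sup (x_mul_nn_mem (F := F) i j) (ih b (by simpa using hb))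
    convert! this using 1
    simp only [xyProd, nnProd, Multiset.map_cons, Multiset.prod_cons]
    ring

theorem nnProd_mem (j : ℕ) : ∀ b : Multiset (Fin m), b.card = j * (p - 1) →
    (nnProd p b : MvPolynomial (Fin m × Fin 2) F) ∈
      (uld p F m).toSubmodule ⊔ LinearMap.range (trP p F m) := by
  induction j with
  | zero =>
    intro b hb
    rw [zero_mul, Multiset.card_eq_zero] at hb
    subst hb
    simp only [nnProd, Multiset.map_zero, Multiset.prod_zero]
    exact Submodule.mem_sup_left (one_mem (uld p F m))
  | succ j ih =>
    intro b hb
    obtain ⟨b₁, b₂, rfl, h1, h2⟩ := exists_multiset_add b (hb.trans (Nat.succ_mul _ _))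
    rw [nnProd_add]
    refine mul_mem_uld_sup (ih _ h1) ?_
    obtain ⟨h, hh⟩ := exists_dd_eq (F := F) h2
    rw [eq_sub_of_add_eq hh.symm, sub_eq_add_neg, ← map_neg]
    exact Submodule.add_mem_sup (dd_mem_uld h2) ⟨_, rfl⟩

theorem sum_erase_castHom_pow {i : ℕ} (hi : ¬ (p - 1) ∣ i) :
    ∑ c ∈ Finset.univ.erase (0 : ZMod p), (ZMod.castHom (dvd_refl p) F c) ^ i = 0 := by
  have h0 : i ≠ 0 := fun h => hi (h ▸ dvd_zero _)
  have := sum_map_pow (ZMod.castHom (dvd_refl p) F) h0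
  rw [if_neg hi] at this
  rw [← this]
  exact Finset.sum_erase _ (by rw [map_zero, zero_pow h0])

/-- The sum over the diagonal torus. -/
noncomputable def trT (p : ℕ) [Fact p.Prime] (F : Type*) [Field F] [CharP F p] (m : ℕ) :
    MvPolynomial (Fin m × Fin 2) F →ₗ[F] MvPolynomial (Fin m × Fin 2) F :=
  ∑ c ∈ Finset.univ.erase (0 : ZMod p), (gsub (rowRep (c, 0))).toLinearMap

theorem trT_apply (f : MvPolynomial (Fin m × Fin 2) F) :
    trT p F m f = ∑ c ∈ Finset.univ.erase (0 : ZMod p), gsub (rowRep (c, 0)) f := by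
  simp [trT]

theorem trT_of_mem {f : MvPolynomial (Fin m × Fin 2) F} (hf : f ∈ vectorInvariants p F m) :
    trT p F m f = -f := by
  rw [trT_apply, Finset.sum_congr rfl fun c _ => mem_vectorInvariants.1 hf _, Finset.sum_const,
    Finset.card_erase_of_mem (Finset.mem_univ _), Finset.card_univ, ZMod.card, nsmul_eq_mul,
    Nat.cast_sub (Fact.out : p.Prime).one_le]
  simp

theorem unip_mul_diag {c : ZMod p} (hc : c ≠ 0) (s : ZMod p) :
    unip s * rowRep (c, 0) = rowRep (c, 0) * unip (c * c * s) := by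
  apply Subtype.ext
  ext i j
  rw [sl_mul_apply, sl_mul_apply]
  fin_cases i <;> fin_cases j <;> simp [unip, rowRep, hc]
  field_simp

theorem trT_trP_mem (h : MvPolynomial (Fin m × Fin 2) F) :
    trT p F m (trP p F m h) ∈ LinearMap.range (trP p F m) := by
  rw [trT_apply]
  refine sum_mem fun c hc => ⟨gsub (rowRep (c, 0)) h, ?_⟩
  have hc := Finset.ne_of_mem_erase hc
  simp only [trP_apply, map_sum, gsub_gsub]
  refine (Fintype.sum_equiv (Equiv.mulLeft₀ (c * c) (mul_ne_zero hc hc)) _ _ fun s => ?_).symm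
  rw [unip_mul_diag hc]
  rfl

/-- The torus acts on this product with weight `|a| - |b|`, written `|a| + (p - 2)|b|` to stay in
`ℕ`. The sum vanishes unless `p - 1` divides the weight; then the `x_i` pair off with norms and the
remaining norms group into blocks of `p - 1`. -/
theorem trT_monomial_mem (a b : Multiset (Fin m)) {k : MvPolynomial (Fin m × Fin 2) F}
    (hk : k ∈ uld p F m) : trT p F m (xyProd 0 a * nnProd p b * k) ∈
      (uld p F m).toSubmodule ⊔ LinearMap.range (trP p F m) := by
  have hp := (Fact.out : p.Prime).two_le
  have hk' := uld_le hk
  have h1 : ∀ c ∈ Finset.univ.erase (0 : ZMod p),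
      gsub (rowRep (c, 0)) (xyProd 0 a * nnProd p b * k) =
        ((ZMod.castHom (dvd_refl p) F c) ^ (a.card + (p - 2) * b.card)) •
          (xyProd 0 a * nnProd p b * k) := by
    intro c hc
    have hc := Finset.ne_of_mem_erase hc
    have hi : c⁻¹ = c ^ (p - 2) := by
      refine inv_eq_of_mul_eq_one_right ?_
      rw [← pow_succ', show p - 2 + 1 = p - 1 by lia, ZMod.pow_card_sub_one_eq_one hc]
    rw [map_mul, map_mul, mem_vectorInvariants.1 hk', gsub_diag_xProd hc, gsub_diag_nnProd hc,
      hi, smul_eq_C_mul, pow_add, pow_mul]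
    simp only [C_mul, map_pow]
    ring
  rw [trT_apply, Finset.sum_congr rfl h1, ← Finset.sum_smul]
  by_cases hd : (p - 1) ∣ a.card + (p - 2) * b.card
  swap
  · rw [sum_erase_castHom_pow hd, zero_smul]
    exact zero_mem _
  refine Submodule.smul_mem _ _ ?_
  refine mul_mem_uld_sup ?_ (Submodule.mem_sup_left hk)
  -- With at least `p - 1` factors `x_i` the product is already a transfer. With fewer, divisibility
  -- of the weight forces `|b| ≥ |a|`.
  rcases le_or_gt (p - 1) a.card with ha | ha
  · obtain ⟨a₁, a₂, rfl, h2, -⟩ := exists_multiset_add a (Nat.add_sub_cancel' ha).symm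
    refine Submodule.mem_sup_right ?_
    rw [xyProd_add, mul_assoc, ← neg_neg (xyProd 0 a₁), ← trP_yProd h2, ← map_neg]
    exact trP_mul_mem_range _ (mul_mem (xProd_mem_unip _) (nnProd_mem_unip _))
  · obtain ⟨j, hj⟩ : ∃ j, b.card = a.card + j * (p - 1) := by
      obtain ⟨c, hc⟩ := hd
      obtain ⟨q, rfl⟩ : ∃ q, p = q + 2 := ⟨p - 2, by lia⟩
      simp only [show q + 2 - 1 = q + 1 from rfl, show q + 2 - 2 = q from rfl] at hc ha ⊢
      have hcb : c ≤ b.card := by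
        by_contra hcb
        have : (q + 1) * (b.card + 1) ≤ (q + 1) * c := Nat.mul_le_mul_left _ (by lia)
        nlinarith
      refine ⟨b.card - c, ?_⟩
      zify [hcb] at hc ⊢
      linear_combination -hc
    obtain ⟨b₁, b₂, rfl, h1, h2⟩ := exists_multiset_add b hj
    rw [nnProd_add, ← mul_assoc]
    exact mul_mem_uld_sup (xProd_mul_nnProd_mem a b₁ h1) (nnProd_mem j b₂ h2)

theorem trT_xun_mem {f : MvPolynomial (Fin m × Fin 2) F} (hf : f ∈ xun p F m) :
    trT p F m f ∈ (uld p F m).toSubmodule ⊔ LinearMap.range (trP p F m) := by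
  have hf' : f ∈ Subalgebra.toSubmodule (xun p F m) := hf
  rw [xun, Algebra.adjoin_eq_span] at hf'
  clear hf
  induction hf' using Submodule.span_induction with
  | zero => rw [map_zero]; exact zero_mem _
  | add f g _ _ h1 h2 =>
    rw [map_add]
    exact add_mem h1 h2
  | smul c f _ h1 =>
    rw [map_smul]
    exact Submodule.smul_mem _ _ h1
  | mem f hf1 =>
    suffices H : ∃ (a b : Multiset (Fin m)) (k : MvPolynomial (Fin m × Fin 2) F),
        k ∈ uld p F m ∧ f = xyProd 0 a * nnProd p b * k by
      obtain ⟨a, b, k, hk, rfl⟩ := H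
      exact trT_monomial_mem a b hk
    induction hf1 using Submonoid.closure_induction with
    | one => exact ⟨0, 0, 1, one_mem _, by simp [xyProd, nnProd]⟩
    | mul f g _ _ hf hg =>
      obtain ⟨a, b, k, hk, rfl⟩ := hf
      obtain ⟨a', b', k', hk', rfl⟩ := hg
      refine ⟨a + a', b + b', k * k', mul_mem hk hk', ?_⟩
      rw [xyProd_add, nnProd_add]
      ring
    | mem f hf =>
      obtain ((⟨i, rfl⟩ | ⟨ij, rfl⟩) | ⟨i, rfl⟩) := hf
      · exact ⟨{i}, 0, 1, one_mem _, by simp [xyProd, nnProd]⟩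
      · exact ⟨0, 0, _, uu_mem_uld _ _, by simp [xyProd, nnProd]; rfl⟩
      · exact ⟨0, {i}, 1, one_mem _, by simp [xyProd, nnProd]⟩

/-- The invariants are generated by the `u_ij` and the polarised Dickson invariants up to
transfers. -/
theorem exists_uld_add_trG {f : MvPolynomial (Fin m × Fin 2) F}
    (hf : f ∈ vectorInvariants p F m) : ∃ k ∈ uld p F m, ∃ h, f = k + trG p F m h := by
  have h1 : -f ∈ (uld p F m).toSubmodule ⊔ LinearMap.range (trP p F m) := by
    obtain ⟨a, ha, _, ⟨h, rfl⟩, h2⟩ := Submodule.mem_sup.1 (unip_mem_sup (invariants_le_unip hf))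
    rw [← trT_of_mem hf, ← h2, map_add]
    exact add_mem (trT_xun_mem ha) (Submodule.mem_sup_right (trT_trP_mem h))
  obtain ⟨k, hk, _, ⟨h, rfl⟩, h2⟩ := Submodule.mem_sup.1 h1
  -- The leftover transfer is itself invariant under the whole group, so the relative transfer
  -- negates it and also turns it into `trG h`.
  have h3 : trP p F m h ∈ vectorInvariants p F m := by
    rw [eq_sub_of_add_eq' h2]
    exact sub_mem (neg_mem hf) (uld_le hk)
  have h4 := trRel_of_mem h3
  rw [trRel_trP] at h4
  refine ⟨-k, neg_mem hk, h, ?_⟩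
  rw [h4]
  linear_combination h2

end

/-! ### Reduction modulo the `u_ij` to binary forms -/

section Segre

variable {F : Type*} [Field F] {m : ℕ}

/-- The forms of degree `n` which are combinations of the `u_ij`, with homogeneous coefficients. -/
noncomputable def uuForms (F : Type*) [Field F] (m n : ℕ) : Submodule F (MvPolynomial (Fin m × Fin 2) F) :=
  Submodule.span F {q | ∃ (i j : Fin m) (k : ℕ) (s : MvPolynomial (Fin m × Fin 2) F),
    s.IsHomogeneous k ∧ k + 2 = n ∧ q = uu i j * s}

theorem mul_mem_uuForms {q f : MvPolynomial (Fin m × Fin 2) F} {n a : ℕ}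
    (hq : q ∈ uuForms F m n) (hf : f.IsHomogeneous a) : f * q ∈ uuForms F m (a + n) := by
  induction hq using Submodule.span_induction with
  | zero => rw [mul_zero]; exact zero_mem _
  | add g h _ _ hg hh => rw [mul_add]; exact add_mem hg hh
  | smul c g _ hg => rw [mul_smul_comm]; exact Submodule.smul_mem _ _ hg
  | mem g hg =>
    obtain ⟨i, j, k, s, hs, rfl, rfl⟩ := hg
    exact Submodule.subset_span ⟨i, j, a + k, f * s, hf.mul hs, by lia, by ring⟩

/-- Modulo the `u_ij` one may exchange `x_i y_j` for `x_j y_i`. A common variable is divided out by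
induction; if there is none, one exchange creates it. -/
theorem monomial_sub_mem_uuForms (n : ℕ) : ∀ μ ν : Fin m × Fin 2 →₀ ℕ,
    (∑ i, (μ (i, 0) + μ (i, 1)) = n) → (∀ i, μ (i, 0) + μ (i, 1) = ν (i, 0) + ν (i, 1)) →
    (∑ i, μ (i, 0) = ∑ i, ν (i, 0)) →
    (monomial μ (1 : F) - monomial ν 1) ∈ uuForms F m n := by
  classical
  induction n with
  | zero =>
    intro μ ν hn hw _
    have hz : ∀ i, μ (i, 0) + μ (i, 1) = 0 := fun i =>
      (Finset.sum_eq_zero_iff.1 hn) i (Finset.mem_univ i)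
    have : μ = ν := by
      ext ⟨i, k⟩
      have h1 := hz i
      have h2 := hw i
      fin_cases k <;> simp <;> lia
    rw [this, sub_self]
    exact zero_mem _
  | succ n ih =>
    have share : ∀ μ ν : Fin m × Fin 2 →₀ ℕ,
        (∑ i, (μ (i, 0) + μ (i, 1)) = n + 1) →
        (∀ i, μ (i, 0) + μ (i, 1) = ν (i, 0) + ν (i, 1)) →
        (∑ i, μ (i, 0) = ∑ i, ν (i, 0)) → (∃ ik, μ ik ≠ 0 ∧ ν ik ≠ 0) →
        (monomial μ (1 : F) - monomial ν 1) ∈ uuForms F m (n + 1) := by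
      rintro μ ν hn hw hc ⟨⟨i, k⟩, hμ, hν⟩
      obtain ⟨μ', rfl⟩ : ∃ μ', μ = Finsupp.single (i, k) 1 + μ' :=
        ⟨_, (add_tsub_cancel_of_le (Finsupp.single_le_iff.2 (Nat.pos_of_ne_zero hμ))).symm⟩
      obtain ⟨ν', rfl⟩ : ∃ ν', ν = Finsupp.single (i, k) 1 + ν' :=
        ⟨_, (add_tsub_cancel_of_le (Finsupp.single_le_iff.2 (Nat.pos_of_ne_zero hν))).symm⟩
      have key := mul_mem_uuForms (ih μ' ν' ?_ ?_ ?_) (isHomogeneous_X F (i, k))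
      · rw [add_comm 1 n] at key
        convert! key using 1
        rw [mul_sub, X, monomial_mul, monomial_mul, mul_one]
      · have h1 : ∀ j, (Finsupp.single (i, k) 1 + μ' : Fin m × Fin 2 →₀ ℕ) (j, 0) +
            (Finsupp.single (i, k) 1 + μ' : Fin m × Fin 2 →₀ ℕ) (j, 1) =
             (μ' (j, 0) + μ' (j, 1)) + if j = i then 1 else 0 := by
          intro j
          by_cases hj : j = i
          · subst hj
            fin_cases k <;> simp <;> lia
          · simp [hj]
        rw [Finset.sum_congr rfl fun j _ => h1 j, Finset.sum_add_distrib] at hn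
        simpa using hn
      · intro j
        have := hw j
        simp only [Finsupp.add_apply] at this
        lia
      · simp only [Finsupp.add_apply, Finset.sum_add_distrib] at hc
        lia
    intro μ ν hn hw hc
    by_cases hs : ∃ ik, μ ik ≠ 0 ∧ ν ik ≠ 0
    · exact share μ ν hn hw hc hs
    · push Not at hs
      obtain ⟨i, hi⟩ : ∃ i, μ (i, 0) ≠ 0 := by
        by_contra! h
        obtain ⟨l, -, hl⟩ := Finset.exists_ne_zero_of_sum_ne_zero (hn.trans_ne (Nat.succ_ne_zero n))
        have h2 : ∀ i, ν (i, 0) = 0 := by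
          rw [Finset.sum_eq_zero fun i _ => h i] at hc
          exact fun i => (Finset.sum_eq_zero_iff.1 hc.symm) i (Finset.mem_univ i)
        have := hw l
        have := h l
        have := h2 l
        have := hs (l, 1) (by lia)
        lia
      obtain ⟨j, hj⟩ : ∃ j, ν (j, 0) ≠ 0 := by
        by_contra! h
        rw [Finset.sum_eq_zero (s := Finset.univ) (f := fun i => ν (i, 0)) fun i _ => h i] at hc
        exact hi (Finset.sum_eq_zero_iff.1 hc i (Finset.mem_univ i))
      have hνi := hs _ hi
      have hij : i ≠ j := by
        rintro rfl
        exact hj hνi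
      have hμj : μ (j, 0) = 0 := by
        by_contra h
        exact hj (hs _ h)
      have hμj' : μ (j, 1) ≠ 0 := by
        have := hw j
        lia
      obtain ⟨μ', rfl⟩ : ∃ μ', μ = Finsupp.single (i, 0) 1 + μ' :=
        ⟨_, (add_tsub_cancel_of_le (Finsupp.single_le_iff.2 (Nat.pos_of_ne_zero hi))).symm⟩
      have hμj'' : μ' (j, 1) ≠ 0 := by simpa using hμj'
      obtain ⟨μ, rfl⟩ : ∃ μ, μ' = Finsupp.single (j, 1) 1 + μ :=
        ⟨_, (add_tsub_cancel_of_le (Finsupp.single_le_iff.2 (Nat.pos_of_ne_zero hμj''))).symm⟩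
      -- The exchanged monomial contains `y_i`, which `ν` also contains: it has positive degree in
      -- the vector `i` but no `x_i`.
      set ρ : Fin m × Fin 2 →₀ ℕ := Finsupp.single (i, 1) 1 + (Finsupp.single (j, 0) 1 + μ) with hρ
      have e0 : ∀ l, ρ (l, 0) = μ (l, 0) + if l = j then 1 else 0 := by
        intro l
        by_cases hl : l = j
        · subst hl
          simp [hρ, add_comm]
        · simp [hρ, hl]
      have e1 : ∀ l, ρ (l, 1) = μ (l, 1) + if l = i then 1 else 0 := by
        intro l
        by_cases hl : l = i
        · subst hl
          simp [hρ, add_comm]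
        · simp [hρ, hl]
      have d0 : ∀ l, (Finsupp.single (i, 0) 1 + (Finsupp.single (j, 1) 1 + μ) :
          Fin m × Fin 2 →₀ ℕ) (l, 0) = μ (l, 0) + if l = i then 1 else 0 := by
        intro l
        by_cases hl : l = i
        · subst hl
          simp [add_comm]
        · simp [hl]
      have d1 : ∀ l, (Finsupp.single (i, 0) 1 + (Finsupp.single (j, 1) 1 + μ) :
          Fin m × Fin 2 →₀ ℕ) (l, 1) = μ (l, 1) + if l = j then 1 else 0 := by
        intro l
        by_cases hl : l = j
        · subst hl
          simp [add_comm]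
        · simp [hl]
      have hsum : ∑ l, (μ (l, 0) + μ (l, 1)) + 2 = n + 1 := by
        rw [← hn]
        simp only [d0, d1, Finset.sum_add_distrib]
        simp
        lia
      have h1 : monomial (Finsupp.single (i, 0) 1 + (Finsupp.single (j, 1) 1 + μ)) (1 : F) -
          monomial ρ 1 ∈ uuForms F m (n + 1) := by
        refine Submodule.subset_span ⟨i, j, _, monomial μ 1, ?_, hsum, ?_⟩
        · have := isWeightedHomogeneous_monomial mdeg μ (1 : F) rfl
          have h2 := IsMulti.isHomogeneous this
          rwa [Finset.sum_congr rfl fun l _ => weight_mdeg μ l] at h2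
        · rw [hρ, uu, sub_mul]
          simp only [X, monomial_mul, mul_one]
          congr 2 <;> abel_nf
      have h2 := share ρ ν ?_ ?_ ?_ ⟨(i, 1), by simp [hρ], ?_⟩
      · have := add_mem h1 h2
        rwa [sub_add_sub_cancel] at this
      · rw [← hsum]
        simp only [e0, e1, Finset.sum_add_distrib]
        simp
        lia
      · intro l
        rw [← hw l, e0, e1, d0, d1]
        lia
      · rw [← hc]
        simp only [e0, d0, Finset.sum_add_distrib]
        simp
      · have := hw i
        rw [d0, if_pos rfl] at this
        lia

/-- The specialisation of every vector to `(1, T)`. -/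
noncomputable def toPoly (F : Type*) [Field F] (m : ℕ) :
    MvPolynomial (Fin m × Fin 2) F →ₐ[F] Polynomial F :=
  aeval fun ik => ![1, Polynomial.X] ik.2

theorem toPoly_monomial (d : Fin m × Fin 2 →₀ ℕ) (r : F) :
    toPoly F m (monomial d r) = Polynomial.C r * Polynomial.X ^ ∑ i, d (i, 1) := by
  rw [toPoly, aeval_monomial, Finsupp.prod_fintype _ _ (by simp), Fintype.prod_prod_type,
    ← Finset.prod_pow_eq_pow_sum]
  simp [Fin.prod_univ_two]

theorem sum_weight {d : Fin m × Fin 2 →₀ ℕ} {e : Fin m → ℕ} (h : Finsupp.weight mdeg d = e) :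
    ∑ i, d (i, 0) + ∑ i, d (i, 1) = ∑ i, e i := by
  rw [← Finset.sum_add_distrib, ← h]
  simp only [weight_mdeg]

theorem sum_add_sum_eq_degree {d : Fin m × Fin 2 →₀ ℕ} {n : ℕ} (hr : Finsupp.weight 1 d = n) :
    ∑ i, d (i, 0) + ∑ i, d (i, 1) = n := by
  rw [← hr, Finsupp.weight_apply, Finsupp.sum_fintype _ _ (by simp),
    Fintype.sum_prod_type, ← Finset.sum_add_distrib]
  simp [Fin.sum_univ_two]

/-- Choose one monomial of multidegree `e` for each attainable power of `T`. This gives a linear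
section `lift` of `toPoly`, and each monomial agrees with its lift modulo the `u_ij`. -/
theorem mem_uuForms_of_toPoly {h : MvPolynomial (Fin m × Fin 2) F} {e : Fin m → ℕ}
    (he : IsMulti h e) (h0 : toPoly F m h = 0) : h ∈ uuForms F m (∑ i, e i) := by
  classical
  let rep : ℕ → MvPolynomial (Fin m × Fin 2) F := fun k =>
    if H : ∃ d : Fin m × Fin 2 →₀ ℕ, Finsupp.weight mdeg d = e ∧ ∑ i, d (i, 1) = k then
      monomial H.choose 1 else 0
  let lift : Polynomial F →ₗ[F] MvPolynomial (Fin m × Fin 2) F :=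
    ∑ k ∈ Finset.range (∑ i, e i + 1), (Polynomial.lcoeff F k).smulRight (rep k)
  suffices H : h - lift (toPoly F m h) ∈ uuForms F m (∑ i, e i) by
    rwa [h0, map_zero, sub_zero] at H
  clear h0
  induction he using IsWeightedHomogeneous.induction_on with
  | zero => simp
  | add f g _ _ hf hg =>
    convert! add_mem hf hg using 1
    rw [map_add, map_add]
    ring
  | monomial d r hr =>
    have hs := sum_weight hr
    have H : ∃ d' : Fin m × Fin 2 →₀ ℕ, Finsupp.weight mdeg d' = e ∧
        ∑ i, d' (i, 1) = ∑ i, d (i, 1) := ⟨d, hr, rfl⟩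
    have h1 : lift (toPoly F m (monomial d r)) = r • monomial H.choose 1 := by
      rw [toPoly_monomial]
      simp only [lift, LinearMap.sum_apply, LinearMap.smulRight_apply, Polynomial.lcoeff_apply,
        Polynomial.coeff_C_mul, Polynomial.coeff_X_pow]
      rw [Finset.sum_eq_single (∑ i, d (i, 1))]
      · simp only [if_true, mul_one, rep]
        rw [dif_pos H]
      · intro k _ hk
        rw [if_neg hk]
        simp
      · intro h
        exact absurd (Finset.mem_range.2 (by lia)) h
    have h2 : monomial d r = r • (monomial d (1 : F)) := by
      rw [smul_monomial, smul_eq_mul, mul_one]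
    rw [h1, h2, ← smul_sub]
    refine Submodule.smul_mem _ _ (monomial_sub_mem_uuForms _ _ _ ?_ ?_ ?_)
    · rw [Finset.sum_add_distrib, hs]
    · intro i
      rw [← weight_mdeg, ← weight_mdeg, hr, H.choose_spec.1]
    · have h3 := sum_weight H.choose_spec.1
      have h4 := H.choose_spec.2
      lia

theorem exists_le_sum_eq (e : Fin m → ℕ) (k : ℕ) (hk : k ≤ ∑ i, e i) :
    ∃ a : Fin m → ℕ, a ≤ e ∧ ∑ i, a i = k := by
  induction k with
  | zero => exact ⟨0, fun _ => Nat.zero_le _, by simp⟩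
  | succ k ih =>
    obtain ⟨a, ha, hs⟩ := ih (by lia)
    obtain ⟨i, -, hi⟩ := Finset.exists_lt_of_sum_lt (s := Finset.univ) (f := a) (g := e) (by lia)
    refine ⟨a + Pi.single i 1, fun j => ?_, ?_⟩
    · rcases eq_or_ne j i with rfl | hj
      · simpa using hi
      · simpa [hj] using ha j
    · simp [Finset.sum_add_distrib, hs]

theorem exists_toPoly_eq (e : Fin m → ℕ) {q : Polynomial F} (hq : q.natDegree ≤ ∑ i, e i) :
    ∃ h : MvPolynomial (Fin m × Fin 2) F, IsMulti h e ∧ toPoly F m h = q := by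
  have h1 : ∀ k ∈ Finset.range (∑ i, e i + 1), ∃ h : MvPolynomial (Fin m × Fin 2) F,
      IsMulti h e ∧ toPoly F m h = Polynomial.C (q.coeff k) * Polynomial.X ^ k := by
    intro k hk
    obtain ⟨a, ha, hs⟩ := exists_le_sum_eq e k (by have := Finset.mem_range.1 hk; lia)
    let d : Fin m × Fin 2 →₀ ℕ := Finsupp.equivFunOnFinite.symm
      fun ik => ![e ik.1 - a ik.1, a ik.1] ik.2
    refine ⟨monomial d (q.coeff k), isWeightedHomogeneous_monomial _ _ _ ?_, ?_⟩
    · ext i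
      rw [weight_mdeg]
      simpa [d] using Nat.sub_add_cancel (ha i)
    · rw [toPoly_monomial, ← hs]
      simp [d]
  choose! g hg1 hg2 using h1
  refine ⟨∑ k ∈ Finset.range (∑ i, e i + 1), g k, IsWeightedHomogeneous.sum _ _ _ fun k hk => ?_, ?_⟩
  · exact hg1 k hk
  · rw [map_sum, Finset.sum_congr rfl hg2]
    conv_rhs => rw [q.as_sum_range' (∑ i, e i + 1) (by lia)]
    simp only [Polynomial.C_mul_X_pow_eq_monomial]

/-- Evaluation with all vectors equal to `(a, b)`. -/
noncomputable def evP {F : Type*} [Field F] {m : ℕ} (a b : F) :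
    MvPolynomial (Fin m × Fin 2) F →ₐ[F] F :=
  aeval fun ik => ![a, b] ik.2

theorem eval_toPoly (t : F) (h : MvPolynomial (Fin m × Fin 2) F) :
    (toPoly F m h).eval t = evP 1 t h := by
  have : (Polynomial.aeval t).comp (toPoly F m) = evP (m := m) 1 t := by
    ext ⟨i, k⟩
    fin_cases k <;> simp [toPoly, evP]
  rw [← this]
  simp

theorem evP_smul {h : MvPolynomial (Fin m × Fin 2) F} {n : ℕ} (hh : h.IsHomogeneous n)
    (c a b : F) : evP (c * a) (c * b) h = c ^ n * evP a b h := by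
  induction hh using IsWeightedHomogeneous.induction_on with
  | zero => simp
  | add f g _ _ hf hg => rw [map_add, map_add, hf, hg, mul_add]
  | monomial d r hr =>
    have h1 : ∀ ik : Fin m × Fin 2, ![c * a, c * b] ik.2 = c * ![a, b] ik.2 := by
      rintro ⟨i, k⟩
      fin_cases k <;> simp
    rw [evP, evP, aeval_monomial, aeval_monomial]
    simp only [h1, mul_pow, Finsupp.prod_mul]
    rw [← hr, Finsupp.weight_apply, Finsupp.prod, Finset.prod_pow_eq_pow_sum]
    simp [Finsupp.sum]
    ring

theorem toPoly_natDegree_le {h : MvPolynomial (Fin m × Fin 2) F} {n : ℕ}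
    (he : h.IsHomogeneous n) : (toPoly F m h).natDegree ≤ n ∧
      (toPoly F m h).coeff n = evP 0 1 h := by
  induction he using IsWeightedHomogeneous.induction_on with
  | zero => simp
  | add f g _ _ hf hg =>
    rw [map_add, map_add]
    refine ⟨(Polynomial.natDegree_add_le _ _).trans (max_le hf.1 hg.1), ?_⟩
    rw [Polynomial.coeff_add, hf.2, hg.2]
  | monomial d r hr =>
    have hs := sum_add_sum_eq_degree hr
    rw [toPoly_monomial]
    refine ⟨(Polynomial.natDegree_C_mul_X_pow_le _ _).trans (by lia), ?_⟩
    rw [Polynomial.coeff_C_mul_X_pow, evP, aeval_monomial, Finsupp.prod_fintype _ _ (by simp),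
      Fintype.prod_prod_type]
    simp only [Fin.prod_univ_two, Matrix.cons_val_zero, Matrix.cons_val_one, one_pow, mul_one,
      Finset.prod_pow_eq_pow_sum]
    rcases Nat.eq_zero_or_pos (∑ i, d (i, 0)) with h0 | h0
    · rw [if_pos (by lia), h0]
      simp
    · rw [if_neg (by lia), zero_pow h0.ne', mul_zero]

end Segre

/-! ### Values on the projective line over the prime field -/

section Points

variable {p : ℕ} [Fact p.Prime] {F : Type*} [Field F] [CharP F p] {m : ℕ}

theorem evP_gsub (g : Matrix.SpecialLinearGroup (Fin 2) (ZMod p)) (a b : F)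
    (h : MvPolynomial (Fin m × Fin 2) F) :
    evP a b (gsub g h) =
      evP (ZMod.castHom (dvd_refl p) F (g.1 0 0) * a + ZMod.castHom (dvd_refl p) F (g.1 0 1) * b)
        (ZMod.castHom (dvd_refl p) F (g.1 1 0) * a +
          ZMod.castHom (dvd_refl p) F (g.1 1 1) * b) h := by
  set a' := ZMod.castHom (dvd_refl p) F (g.1 0 0) * a + ZMod.castHom (dvd_refl p) F (g.1 0 1) * b
  set b' := ZMod.castHom (dvd_refl p) F (g.1 1 0) * a + ZMod.castHom (dvd_refl p) F (g.1 1 1) * b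
  have : (evP a b).comp (gsub g) = evP (m := m) a' b' := by
    ext ⟨i, k⟩
    rw [AlgHom.comp_apply, gsub_X]
    fin_cases k <;> simp [evP, a', b']
  rw [← this]
  rfl

theorem dvd_of_eval_eq_zero {r : Polynomial F}
    (hr : ∀ t : ZMod p, r.eval (ZMod.castHom (dvd_refl p) F t) = 0) :
    Polynomial.X ^ p - Polynomial.X ∣ r := by
  have hp := (Fact.out : p.Prime).one_lt
  have hm : (Polynomial.X ^ p - Polynomial.X : Polynomial F).Monic :=
    Polynomial.monic_X_pow_sub (by rw [Polynomial.degree_X]; exact_mod_cast hp)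
  rw [← Polynomial.modByMonic_eq_zero_iff_dvd hm]
  refine Polynomial.eq_zero_of_natDegree_lt_card_of_eval_eq_zero _
    (f := ZMod.castHom (dvd_refl p) F) (RingHom.injective _) (fun t => ?_) ?_
  · have h1 := congrArg (Polynomial.eval (ZMod.castHom (dvd_refl p) F t))
      (Polynomial.modByMonic_add_div r (Polynomial.X ^ p - Polynomial.X))
    rwa [Polynomial.eval_add, Polynomial.eval_mul, Polynomial.eval_sub, Polynomial.eval_pow,
      Polynomial.eval_X, castHom_pow, sub_self, zero_mul, add_zero, hr] at h1
  · rw [ZMod.card]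
    refine (Polynomial.natDegree_modByMonic_lt _ hm ?_).trans_eq
      (FiniteField.X_pow_card_sub_X_natDegree_eq F hp)
    intro h
    have := FiniteField.X_pow_card_sub_X_natDegree_eq F hp
    rw [h, Polynomial.natDegree_one] at this
    lia

variable {A : Subalgebra F (MvPolynomial (Fin m × Fin 2) F)} {n : ℕ}

theorem trG_mem_of_uuForms (huu : ∀ i j : Fin m, uu i j ∈ A)
    (ih : ∀ k < n, ∀ s : MvPolynomial (Fin m × Fin 2) F, s.IsHomogeneous k → trG p F m s ∈ A)
    {h : MvPolynomial (Fin m × Fin 2) F} (hh : h ∈ uuForms F m n) : trG p F m h ∈ A := by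
  induction hh using Submodule.span_induction with
  | zero => rw [map_zero]; exact zero_mem _
  | add g h _ _ hg hh => rw [map_add]; exact add_mem hg hh
  | smul c g _ hg => rw [map_smul]; exact Subalgebra.smul_mem _ hg _
  | mem g hg =>
    obtain ⟨i, j, k, s, hs, hk, rfl⟩ := hg
    rw [trG_mul (uu_mem i j)]
    exact mul_mem (huu i j) (ih k (by lia) s hs)

/-- A binary form vanishing at all `p + 1` rational points is divisible by the Dickson form `T^p -
T`, the specialisation of `l_ji`. Degree `p` in the vector `i` and one more elsewhere leave room for
`l_ji` in the multidegree, so `h` is a multiple of it modulo the `u_ij`. -/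
theorem trG_mem_of_vanishing (huu : ∀ i j : Fin m, uu i j ∈ A) (hll : ∀ i j : Fin m, ll p i j ∈ A)
    (ih : ∀ k < n, ∀ s : MvPolynomial (Fin m × Fin 2) F, s.IsHomogeneous k → trG p F m s ∈ A)
    {e : Fin m → ℕ} (hn : ∑ i, e i = n) {i : Fin m} (hi : p ≤ e i) (hpn : p + 1 ≤ n)
    {h : MvPolynomial (Fin m × Fin 2) F} (he : IsMulti h e)
    (h1 : ∀ t : ZMod p, evP 1 (ZMod.castHom (dvd_refl p) F t) h = 0) (h2 : evP 0 1 h = 0) :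
    trG p F m h ∈ A := by
  have hp := (Fact.out : p.Prime).one_lt
  obtain ⟨hd, hc⟩ := toPoly_natDegree_le he.isHomogeneous
  obtain ⟨r, hr⟩ := dvd_of_eval_eq_zero (r := toPoly F m h) fun t => by rw [eval_toPoly, h1]
  obtain ⟨e₁, rfl⟩ : ∃ e₁, e = p • Pi.single i 1 + e₁ := by
    refine ⟨e - p • Pi.single i 1, (add_tsub_cancel_of_le fun k => ?_).symm⟩
    rcases eq_or_ne k i with rfl | hk
    · simpa using hi
    · simp [hk]
  have hs1 : ∑ k, e₁ k + p = n := by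
    rw [← hn]
    simp [Finset.sum_add_distrib, ← Finset.mul_sum, add_comm]
  obtain ⟨j, -, hj⟩ := Finset.exists_ne_zero_of_sum_ne_zero (s := Finset.univ) (f := e₁)
    (by lia)
  obtain ⟨e₂, rfl⟩ := exists_add_single hj
  have hs2 : ∑ k, e₂ k + 1 + p = n := by
    rw [← hs1]
    simp [Finset.sum_add_distrib]
  -- Vanishing at infinity lowers the degree by one, exactly what the factor `l_ji`, of degree `p +
  -- 1` rather than `p`, costs.
  have hrd : r.natDegree ≤ ∑ k, e₂ k := by
    rcases eq_or_ne r 0 with rfl | hr0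
    · simp
    have h3 : (toPoly F m h).natDegree = p + r.natDegree := by
      rw [hr, Polynomial.natDegree_mul (FiniteField.X_pow_card_sub_X_ne_zero F hp) hr0,
        FiniteField.X_pow_card_sub_X_natDegree_eq F hp]
    have h4 : (toPoly F m h).natDegree ≠ n := by
      intro h5
      rw [h2, hn, ← h5, Polynomial.coeff_natDegree, Polynomial.leadingCoeff_eq_zero, hr] at hc
      exact mul_ne_zero (FiniteField.X_pow_card_sub_X_ne_zero F hp) hr0 hc
    lia
  obtain ⟨h', he', hh'⟩ := exists_toPoly_eq e₂ hrd
  have hdiff : toPoly F m (h - ll p j i * h') = 0 := by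
    rw [map_sub, map_mul, hh', hr, sub_eq_zero]
    congr 1
    simp [toPoly, ll]
  have hmul : IsMulti (ll p j i * h') (p • Pi.single i 1 + (e₂ + Pi.single j 1)) := by
    convert! (isMulti_ll (p := p) (F := F) j i).mul he' using 1
    abel
  have h6 := trG_mem_of_uuForms huu ih
    (hn ▸ mem_uuForms_of_toPoly (IsWeightedHomogeneous.sub he hmul) hdiff)
  have h7 : trG p F m (ll p j i * h') ∈ A := by
    rw [trG_mul (ll_mem j i)]
    exact mul_mem (hll j i) (ih _ (by lia) _ he'.isHomogeneous)
  have := add_mem h6 h7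
  rwa [← map_add, sub_add_cancel] at this

end Points

/-! ### Products of norms and coordinates, and their values -/

section Multisets

variable {p : ℕ} [Fact p.Prime] {F : Type*} [Field F] [CharP F p] {m : ℕ}

theorem exists_multiset_count (e : Fin m → ℕ) :
    ∃ a : Multiset (Fin m), (fun j => a.count j) = e ∧ a.card = ∑ j, e j := by
  classical
  refine ⟨Finsupp.toMultiset (Finsupp.equivFunOnFinite.symm e), ?_, ?_⟩
  · ext j
    rw [Finsupp.count_toMultiset]
    rfl
  · rw [Finsupp.card_toMultiset, Finsupp.sum_fintype _ _ (by simp)]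
    rfl

theorem isMulti_xyProd (k : Fin 2) (a : Multiset (Fin m)) :
    IsMulti (xyProd k a : MvPolynomial (Fin m × Fin 2) F) fun j => a.count j := by
  induction a using Multiset.induction_on with
  | empty =>
    rw [xyProd, Multiset.map_zero, Multiset.prod_zero]
    convert! isWeightedHomogeneous_one F _ using 1
  | cons i a ih =>
    have := (isMulti_X (F := F) i k).mul ih
    rw [xyProd, Multiset.map_cons, Multiset.prod_cons]
    convert! this using 1
    ext j
    rcases eq_or_ne j i with rfl | h
    · simp [add_comm]
    · simp [h]

theorem isMulti_nnProd (b : Multiset (Fin m)) :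
    IsMulti (nnProd p b : MvPolynomial (Fin m × Fin 2) F) fun j => p * b.count j := by
  induction b using Multiset.induction_on with
  | empty =>
    rw [nnProd, Multiset.map_zero, Multiset.prod_zero]
    convert! isWeightedHomogeneous_one F _ using 1
  | cons i b ih =>
    have := (isMulti_nn (p := p) (F := F) i).mul ih
    rw [nnProd, Multiset.map_cons, Multiset.prod_cons]
    convert! this using 1
    ext j
    rcases eq_or_ne j i with rfl | h
    · simp [mul_add, add_comm]
    · simp [h]

theorem isHomogeneous_xyProd (k : Fin 2) (a : Multiset (Fin m)) :
    (xyProd k a : MvPolynomial (Fin m × Fin 2) F).IsHomogeneous a.card := by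
  have := (isMulti_xyProd (F := F) k a).isHomogeneous
  rwa [Multiset.sum_count_eq_card fun _ _ => Finset.mem_univ _] at this

theorem isHomogeneous_nnProd (b : Multiset (Fin m)) :
    (nnProd p b : MvPolynomial (Fin m × Fin 2) F).IsHomogeneous (p * b.card) := by
  have := (isMulti_nnProd (p := p) (F := F) b).isHomogeneous
  rwa [← Finset.mul_sum, Multiset.sum_count_eq_card fun _ _ => Finset.mem_univ _] at this

theorem isMulti_dd (b : Multiset (Fin m)) : IsMulti (dd p F b) fun j => p * b.count j := by
  rw [dd, trRel_apply]
  exact IsWeightedHomogeneous.neg (IsWeightedHomogeneous.sum _ _ _ fun v _ =>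
    (isMulti_nnProd b).gsub _)

theorem isHomogeneous_dd (b : Multiset (Fin m)) : (dd p F b).IsHomogeneous (p * b.card) := by
  have := (isMulti_dd (p := p) (F := F) b).isHomogeneous
  rwa [← Finset.mul_sum, Multiset.sum_count_eq_card fun _ _ => Finset.mem_univ _] at this

theorem evP_nn (a b : F) (i : Fin m) : evP a b (nn p i) = b ^ p - a ^ (p - 1) * b := by
  simp [evP, nn]

theorem evP_one_nnProd {b : Multiset (Fin m)} (hb : b ≠ 0) (t : ZMod p) :
    evP 1 (ZMod.castHom (dvd_refl p) F t) (nnProd p b) = 0 := by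
  obtain ⟨i, hi⟩ := Multiset.exists_mem_of_ne_zero hb
  rw [nnProd, map_multiset_prod, Multiset.map_map]
  refine Multiset.prod_eq_zero (Multiset.mem_map.2 ⟨i, hi, ?_⟩)
  rw [Function.comp_apply, evP_nn, castHom_pow, one_pow, one_mul, sub_self]

theorem evP_zero_nnProd (b : Multiset (Fin m)) : evP (0 : F) 1 (nnProd p b) = 1 := by
  have hp := (Fact.out : p.Prime).one_lt
  rw [nnProd, map_multiset_prod, Multiset.map_map]
  refine Multiset.prod_eq_one fun x hx => ?_
  obtain ⟨i, _, rfl⟩ := Multiset.mem_map.1 hx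
  rw [Function.comp_apply, evP_nn, zero_pow (by lia)]
  simp

theorem evP_zero_yProd (a : Multiset (Fin m)) : evP (0 : F) 1 (xyProd 1 a) = 1 := by
  rw [xyProd, map_multiset_prod, Multiset.map_map]
  refine Multiset.prod_eq_one fun x hx => ?_
  obtain ⟨i, _, rfl⟩ := Multiset.mem_map.1 hx
  simp [evP]

/-- `P` fixes the point `(0, 1)`, so the value there is a sum of `p` equal terms. -/
theorem evP_zero_trP (h : MvPolynomial (Fin m × Fin 2) F) :
    evP (0 : F) 1 (trP p F m h) = 0 := by
  rw [trP_apply, map_sum]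
  have : ∀ s : ZMod p, evP (0 : F) 1 (gsub (unip s) h) = evP (0 : F) 1 h := by
    intro s
    rw [evP_gsub]
    simp [unip]
  rw [Finset.sum_congr rfl fun s _ => this s, Finset.sum_const, Finset.card_univ, ZMod.card,
    nsmul_eq_mul, CharP.cast_eq_zero, zero_mul]

theorem evP_zero_dd {b : Multiset (Fin m)} (hb : b.card = p - 1) : evP 0 1 (dd p F b) = 1 := by
  obtain ⟨h, hh⟩ := exists_dd_eq (F := F) hb
  rw [hh, map_add, evP_zero_trP, evP_zero_nnProd, add_zero]

theorem gsub_diag_yProd {c : ZMod p} (hc : c ≠ 0) (a : Multiset (Fin m)) :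
    gsub (rowRep (c, 0)) (xyProd 1 a : MvPolynomial (Fin m × Fin 2) F) =
      C (ZMod.castHom (dvd_refl p) F c⁻¹) ^ a.card * xyProd 1 a := by
  rw [xyProd, map_multiset_prod, Multiset.map_map]
  simp only [Function.comp_def, gsub_diag_y hc]
  rw [Multiset.prod_map_mul, Multiset.map_const', Multiset.prod_replicate]

/-- The transfer is unchanged by the torus, which scales this product by a nontrivial character. -/
theorem trG_nnProd_mul_yProd_eq_zero {a b : Multiset (Fin m)} (hn : ¬ (p - 1) ∣ b.card + a.card) :
    trG p F m (nnProd p b * xyProd 1 a) = 0 := by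
  have h1 : ∃ c : (ZMod p)ˣ, c ^ (b.card + a.card) ≠ 1 := by
    by_contra! h
    have := (FiniteField.forall_pow_eq_one_iff (ZMod p) (b.card + a.card)).1 h
    rw [ZMod.card] at this
    exact hn this
  obtain ⟨c, hc⟩ := h1
  have h2 := trG_gsub (F := F) (rowRep ((c⁻¹ : (ZMod p)ˣ), 0)) (nnProd p b * xyProd (m := m) 1 a)
  have h3 : gsub (rowRep (((c⁻¹ : (ZMod p)ˣ) : ZMod p), 0))
      (nnProd p b * xyProd 1 a : MvPolynomial (Fin m × Fin 2) F) =
      (ZMod.castHom (dvd_refl p) F (c : ZMod p)) ^ (b.card + a.card) •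
        (nnProd p b * xyProd 1 a) := by
    rw [map_mul, gsub_diag_nnProd (Units.ne_zero _), gsub_diag_yProd (Units.ne_zero _),
      Units.val_inv_eq_inv_val, inv_inv, smul_eq_C_mul, map_pow, pow_add]
    ring
  rw [h3, map_smul] at h2
  have h4 : ((ZMod.castHom (dvd_refl p) F (c : ZMod p)) ^ (b.card + a.card) - 1) •
      trG p F m (nnProd p b * xyProd 1 a) = 0 := by
    rw [sub_smul, one_smul, h2, sub_self]
  refine (smul_eq_zero.1 h4).resolve_left fun h => hc ?_
  rw [sub_eq_zero, ← map_pow] at h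
  have := RingHom.injective (ZMod.castHom (dvd_refl p) F) (h.trans (map_one _).symm)
  exact Units.ext (by simpa using this)

end Multisets

/-! ### Decomposing transfers by induction on the degree -/

section Descent

variable {p : ℕ} [Fact p.Prime] {F : Type*} [Field F] [CharP F p] {m : ℕ}
variable {A : Subalgebra F (MvPolynomial (Fin m × Fin 2) F)} {n : ℕ}

/-- The matrix moving the point at infinity of the projective line to `t`. -/
def translate (t : ZMod p) : Matrix.SpecialLinearGroup (Fin 2) (ZMod p) :=
  ⟨!![t, -1; 1, 0], by simp [Matrix.det_fin_two]⟩

theorem evP_translate (t : ZMod p) (a b : F) (h : MvPolynomial (Fin m × Fin 2) F) :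
    evP a b (gsub (translate t) h) = evP (ZMod.castHom (dvd_refl p) F t * a - b) a h := by
  rw [evP_gsub]
  congr 2 <;> simp [translate, sub_eq_add_neg]

/-- The translates of `g` are indicators of the other rational points and have the same transfer as
`g`. Subtracting the right combination from `h` makes all its values vanish. -/
theorem trG_mem_of_indicator (hA : uld p F m ≤ A)
    (ih : ∀ k < n, ∀ s : MvPolynomial (Fin m × Fin 2) F, s.IsHomogeneous k → trG p F m s ∈ A)
    {e : Fin m → ℕ} (hn : ∑ i, e i = n) {i : Fin m} (hi : p ≤ e i) (hpn : p + 1 ≤ n)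
    {g : MvPolynomial (Fin m × Fin 2) F} (hg : IsMulti g e)
    (hg1 : ∀ t : ZMod p, evP 1 (ZMod.castHom (dvd_refl p) F t) g = 0) (hg0 : evP 0 1 g = 1)
    (hgA : trG p F m g ∈ A) {h : MvPolynomial (Fin m × Fin 2) F} (he : IsMulti h e) :
    trG p F m h ∈ A := by
  have hgn : g.IsHomogeneous n := hn ▸ hg.isHomogeneous
  have ev0 : ∀ t : ZMod p, evP 0 1 (gsub (translate t) g) = 0 := by
    intro t
    have h1 := evP_smul hgn (-1) 1 0
    have h2 := hg1 0
    rw [map_zero] at h2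
    rw [h2, mul_zero, mul_one, mul_zero] at h1
    rw [evP_translate, mul_zero, zero_sub, h1]
  have ev1 : ∀ t s : ZMod p, evP 1 (ZMod.castHom (dvd_refl p) F s) (gsub (translate t) g) =
      if s = t then 1 else 0 := by
    intro t s
    rw [evP_translate, mul_one, ← map_sub]
    split_ifs with hst
    · subst hst
      rw [sub_self, map_zero, hg0]
    · have hst' : t - s ≠ 0 := sub_ne_zero.2 (Ne.symm hst)
      have h1 := evP_smul hgn (ZMod.castHom (dvd_refl p) F (t - s)) 1
        (ZMod.castHom (dvd_refl p) F (t - s)⁻¹)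
      rw [hg1, mul_zero, ← map_mul, mul_inv_cancel₀ hst', map_one, mul_one] at h1
      rw [h1]
  have key := trG_mem_of_vanishing (h := h - evP 0 1 h • g -
      ∑ t : ZMod p, evP 1 (ZMod.castHom (dvd_refl p) F t) h • gsub (translate t) g)
    (fun i j => hA (uu_mem_uld i j)) (fun i j => hA (ll_mem_uld i j)) ih hn hi hpn ?_ ?_ ?_
  · rw [map_sub, map_sub, map_smul, map_sum] at key
    have h1 : ∑ t : ZMod p, trG p F m (evP 1 (ZMod.castHom (dvd_refl p) F t) h •
        gsub (translate t) g) ∈ A := by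
      refine sum_mem fun t _ => ?_
      rw [map_smul, trG_gsub]
      exact A.smul_mem hgA _
    have := add_mem (add_mem key h1) (A.smul_mem hgA (evP 0 1 h))
    rwa [sub_add_cancel, sub_add_cancel] at this
  · refine IsWeightedHomogeneous.sub (IsWeightedHomogeneous.sub he ?_)
      (IsWeightedHomogeneous.sum _ _ _ fun t _ => ?_)
    · exact (weightedHomogeneousSubmodule F mdeg e).smul_mem _ hg
    · exact (weightedHomogeneousSubmodule F mdeg e).smul_mem _ (hg.gsub _)
  · intro s
    simp only [map_sub, map_sum, map_smul, smul_eq_mul, hg1, ev1]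
    simp
  · simp only [map_sub, map_sum, map_smul, smul_eq_mul, hg0, ev0]
    simp

/-- Take `N_i` times a product of `y_j` as indicator. Its torus weight is congruent to `-n` modulo
`p - 1`, hence nontrivial, and its transfer is zero. -/
theorem trG_mem_of_not_dvd (hA : uld p F m ≤ A)
    (ih : ∀ k < n, ∀ s : MvPolynomial (Fin m × Fin 2) F, s.IsHomogeneous k → trG p F m s ∈ A)
    {e : Fin m → ℕ} (hn : ∑ i, e i = n) {i : Fin m} (hi : p ≤ e i) (hpn : p + 1 ≤ n)
    (hd : ¬ (p - 1) ∣ n) {h : MvPolynomial (Fin m × Fin 2) F} (he : IsMulti h e) :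
    trG p F m h ∈ A := by
  have hp := (Fact.out : p.Prime).one_lt
  obtain ⟨e₁, rfl⟩ : ∃ e₁, e = p • Pi.single i 1 + e₁ := by
    refine ⟨e - p • Pi.single i 1, (add_tsub_cancel_of_le fun k => ?_).symm⟩
    rcases eq_or_ne k i with rfl | hk
    · simpa using hi
    · simp [hk]
  obtain ⟨a, ha, hac⟩ := exists_multiset_count e₁
  have hs1 : a.card + p = n := by
    rw [← hn, hac]
    simp [Finset.sum_add_distrib, ← Finset.mul_sum, add_comm]
  refine trG_mem_of_indicator (g := nnProd p {i} * xyProd 1 a) hA ih hn hi hpn ?_ ?_ ?_ ?_ he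
  · refine IsWeightedHomogeneous.mul ?_ ?_
    · simpa [nnProd] using isMulti_nn i
    · rw [← ha]
      exact isMulti_xyProd 1 a
  · intro t
    rw [map_mul, evP_one_nnProd (by simp), zero_mul]
  · rw [map_mul, evP_zero_nnProd, evP_zero_yProd, one_mul]
  · rw [trG_nnProd_mul_yProd_eq_zero]
    · exact zero_mem _
    · rw [Multiset.card_singleton]
      intro h
      apply hd
      have h2 := dvd_add h (dvd_refl (p - 1))
      rwa [show 1 + a.card + (p - 1) = n by lia] at h2

/-- The hypothesis on quotients makes room for some `d_b`, which comes out of the transfer. Its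
value at infinity is `1`, so a cofactor that is an indicator there suffices. -/
theorem trG_mem_of_sum_div (hA : uld p F m ≤ A)
    (ih : ∀ k < n, ∀ s : MvPolynomial (Fin m × Fin 2) F, s.IsHomogeneous k → trG p F m s ∈ A)
    {e : Fin m → ℕ} (hn : ∑ i, e i = n) {i : Fin m} (hi : p ≤ e i) (hpn : p ^ 2 ≤ n)
    (hs : p - 1 ≤ ∑ j, e j / p) {h : MvPolynomial (Fin m × Fin 2) F} (he : IsMulti h e) :
    trG p F m h ∈ A := by
  have hp := (Fact.out : p.Prime).one_lt
  obtain ⟨a, hae, has⟩ := exists_le_sum_eq _ _ hs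
  obtain ⟨b, hb, hbc⟩ := exists_multiset_count a
  rw [has] at hbc
  obtain ⟨e₁, rfl⟩ : ∃ e₁, e = (fun j => p * a j) + e₁ :=
    ⟨e - fun j => p * a j, (add_tsub_cancel_of_le fun j =>
      (Nat.mul_le_mul_left p (hae j)).trans (Nat.mul_div_le _ _)).symm⟩
  have hs1 : p * (p - 1) + ∑ j, e₁ j = n := by
    rw [← hn, ← has, Finset.mul_sum]
    simp [Finset.sum_add_distrib]
  obtain ⟨q, rfl⟩ : ∃ q, p = q + 1 := ⟨p - 1, by lia⟩
  rw [Nat.add_sub_cancel] at *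
  set n₁ := ∑ j, e₁ j with hn₁
  have hpn1 : q + 1 ≤ n₁ := by nlinarith
  obtain ⟨k, hk⟩ : ∃ k, n₁ = k + (q + 1) := ⟨n₁ - (q + 1), by lia⟩
  -- This polynomial vanishes on `𝔽_p` and is monic of the full degree `n₁`, so its value at
  -- infinity is `1`. The bound `p² ≤ n` guarantees `n₁ ≥ p`.
  have hdeg : (Polynomial.X ^ k * (Polynomial.X ^ (q + 1) - Polynomial.X) :
      Polynomial F).natDegree ≤ ∑ j, e₁ j := by
    rw [← hn₁, hk]
    refine Polynomial.natDegree_mul_le.trans ?_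
    rw [Polynomial.natDegree_X_pow, FiniteField.X_pow_card_sub_X_natDegree_eq F hp]
  obtain ⟨g, hg, hgq⟩ := exists_toPoly_eq e₁ hdeg
  refine trG_mem_of_indicator (g := dd (q + 1) F b * g) hA ih hn hi (by nlinarith) ?_ ?_ ?_ ?_ he
  · refine IsWeightedHomogeneous.mul ?_ hg
    convert! isMulti_dd b using 1
    ext j
    rw [← hb]
  · intro t
    rw [map_mul, ← eval_toPoly, ← eval_toPoly, hgq, Polynomial.eval_mul, Polynomial.eval_sub,
      Polynomial.eval_pow, Polynomial.eval_pow, Polynomial.eval_X, castHom_pow, sub_self, mul_zero,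
      mul_zero]
  · rw [map_mul, evP_zero_dd hbc, one_mul, ← (toPoly_natDegree_le hg.isHomogeneous).2, hgq, ← hn₁, hk, add_comm k,
      Polynomial.coeff_X_pow_mul, Polynomial.coeff_sub, Polynomial.coeff_X_pow_self,
      Polynomial.coeff_X_of_ne_one (by lia), sub_zero]
  · rw [trG_mul (dd_mem b)]
    exact mul_mem (hA (dd_mem_uld hbc)) (ih n₁ (by nlinarith) g hg.isHomogeneous)

/-- Unlike `xProd_mul_nnProd_mem`, this keeps track of what is transferred: it is a combination of
the `u_ij`, so its full transfer falls under the induction on degree. -/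
theorem xProd_mul_nnProd_eq (a : Multiset (Fin m)) : ∀ b : Multiset (Fin m), b.card = a.card →
    ∃ k ∈ uld p F m, ∃ s ∈ uuForms F m ((p + 1) * a.card),
      xyProd 0 a * nnProd p b = k + trP p F m s := by
  have hp := (Fact.out : p.Prime).one_lt
  induction a using Multiset.induction_on with
  | empty =>
    intro b hb
    rw [Multiset.card_zero, Multiset.card_eq_zero] at hb
    subst hb
    exact ⟨1, one_mem _, 0, zero_mem _, by simp [xyProd, nnProd]⟩
  | cons i a ih =>
    intro b hb
    rw [Multiset.card_cons] at hb
    obtain ⟨j, b, rfl⟩ : ∃ j b', b = j ::ₘ b' := by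
      obtain ⟨j, hj⟩ := Multiset.card_pos_iff_exists_mem.1 (hb ▸ Nat.succ_pos _ : 0 < b.card)
      exact ⟨j, Multiset.exists_cons_of_mem hj⟩
    rw [Multiset.card_cons, Nat.add_right_cancel_iff] at hb
    obtain ⟨k, hk, s, hs, hks⟩ := ih b hb
    have hom : (xyProd 0 a * nnProd p b : MvPolynomial (Fin m × Fin 2) F).IsHomogeneous
        ((p + 1) * a.card) := by
      convert! (isHomogeneous_xyProd (F := F) 0 a).mul
        (isHomogeneous_nnProd (p := p) (F := F) b) using 1
      rw [hb]
      ring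
    have hll : (ll p i j : MvPolynomial (Fin m × Fin 2) F).IsHomogeneous (p + 1) := by
      have := (isMulti_ll (p := p) (F := F) i j).isHomogeneous
      simpa [Finset.sum_add_distrib, ← Finset.mul_sum, add_comm] using this
    refine ⟨ll p i j * k, mul_mem (ll_mem_uld i j) hk, ll p i j * s +
      (xyProd 0 a * nnProd p b) * (uu i j * X (j, 1) ^ (p - 1)), add_mem ?_ ?_, ?_⟩
    · rw [Multiset.card_cons, mul_add, mul_one, add_comm]
      exact mul_mem_uuForms hs hll
    · refine Submodule.subset_span ⟨i, j, _, (xyProd 0 a * nnProd p b) * X (j, 1) ^ (p - 1),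
        hom.mul (isHomogeneous_X_pow _ _), ?_, by ring⟩
      rw [Multiset.card_cons, mul_add]
      lia
    · rw [map_add, trP_mul (invariants_le_unip (ll_mem i j)),
        trP_mul (mul_mem (xProd_mem_unip a) (nnProd_mem_unip b))]
      have h1 : xyProd 0 (i ::ₘ a) * nnProd p (j ::ₘ b) =
          (X (i, 0) * nn p j) * (xyProd 0 a * nnProd p b : MvPolynomial (Fin m × Fin 2) F) := by
        simp only [xyProd, nnProd, Multiset.map_cons, Multiset.prod_cons]
        ring
      rw [h1, x_mul_nn_eq, add_mul]
      nth_rewrite 1 [hks]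
      ring

/-- The indicator is a product of `p - 1` norms and `p - 1` coordinates `y_j`. Transfer to `P` turns
the `y_j` into `x_j` up to sign, and these pair off with the norms into `l_ij`. -/
theorem trG_mem_of_two {A : Subalgebra F (MvPolynomial (Fin 2 × Fin 2) F)} (hA : uld p F 2 ≤ A)
    (ih : ∀ k < n, ∀ s : MvPolynomial (Fin 2 × Fin 2) F, s.IsHomogeneous k → trG p F 2 s ∈ A)
    {e : Fin 2 → ℕ} (hn : ∑ i, e i = n) {i : Fin 2} (hi : p ≤ e i) (hpn : n + 1 = p ^ 2)
    {h : MvPolynomial (Fin 2 × Fin 2) F} (he : IsMulti h e) :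
    trG p F 2 h ∈ A := by
  have hp := (Fact.out : p.Prime).one_lt
  obtain ⟨b, hb, hbc⟩ := exists_multiset_count fun j => e j / p
  obtain ⟨a, ha, hac⟩ := exists_multiset_count fun j => e j % p
  have hmod : ∀ j, p * (e j / p) + e j % p = e j := fun j => Nat.div_add_mod _ _
  have hsum : p * b.card + a.card = n := by
    rw [hbc, hac, Finset.mul_sum, ← Finset.sum_add_distrib, ← hn]
    exact Finset.sum_congr rfl fun j _ => hmod j
  have halt : a.card ≤ 2 * (p - 1) := by
    rw [hac, Fin.sum_univ_two]
    have h0 := Nat.mod_lt (e 0) (by lia : p > 0)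
    have h1 := Nat.mod_lt (e 1) (by lia : p > 0)
    lia
  -- The two remainders total at most `2(p - 1)`, so `n = p² - 1` forces the quotients to sum to `p
  -- - 1`.
  have hcards : b.card = p - 1 ∧ a.card = p - 1 := by
    obtain ⟨q, rfl⟩ : ∃ q, p = q + 1 := ⟨p - 1, by lia⟩
    rw [Nat.add_sub_cancel] at *
    have : b.card = q := by
      apply le_antisymm
      · by_contra! hlt
        nlinarith
      · by_contra! hlt
        nlinarith
    refine ⟨this, ?_⟩
    rw [this] at hsum
    nlinarith
  obtain ⟨hb1, ha1⟩ := hcards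
  have hb0 : b ≠ 0 := by
    rintro rfl
    rw [Multiset.card_zero] at hb1
    lia
  refine trG_mem_of_indicator (g := nnProd p b * xyProd 1 a) hA ih hn hi ?_ ?_ ?_ ?_ ?_ he
  · nlinarith
  · convert! (isMulti_nnProd (p := p) (F := F) b).mul (isMulti_xyProd 1 a) using 1
    ext j
    rw [Pi.add_apply, congrFun hb j, congrFun ha j, hmod]
  · intro t
    rw [map_mul, evP_one_nnProd hb0, zero_mul]
  · rw [map_mul, evP_zero_nnProd, evP_zero_yProd, one_mul]
  · obtain ⟨k, hk, s, hs, hks⟩ := xProd_mul_nnProd_eq (F := F) a b (hb1.trans ha1.symm)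
    rw [← trRel_trP, trP_mul (nnProd_mem_unip b), trP_yProd ha1, mul_neg, mul_comm, hks, map_neg,
      map_add, trRel_trP, trRel_of_mem (uld_le hk)]
    refine neg_mem (add_mem (neg_mem (hA hk)) (trG_mem_of_uuForms (fun i j => hA (uu_mem_uld i j))
      ih ?_))
    convert! hs using 2
    obtain ⟨q, rfl⟩ : ∃ q, p = q + 1 := ⟨p - 1, by lia⟩
    rw [ha1, Nat.add_sub_cancel]
    nlinarith

end Descent

/-! ### All transfers of large degree decompose -/

section Generation

variable {p : ℕ} [Fact p.Prime] {F : Type*} [Field F] [CharP F p] {m : ℕ}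

theorem sum_weight_eq_degree {d : Fin m × Fin 2 →₀ ℕ} {n : ℕ} (hr : Finsupp.weight 1 d = n) :
    ∑ i, (Finsupp.weight mdeg d : Fin m → ℕ) i = n := by
  rw [← sum_weight rfl, sum_add_sum_eq_degree hr]

theorem isHomogeneous_trG {s : MvPolynomial (Fin m × Fin 2) F} {n : ℕ} (hs : s.IsHomogeneous n) :
    (trG p F m s).IsHomogeneous n := by
  induction hs using IsWeightedHomogeneous.induction_on with
  | zero => rw [map_zero]; exact isHomogeneous_zero _ _ _
  | add f g _ _ hf hg => rw [map_add]; exact hf.add hg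
  | monomial d r hr =>
    have h1 : IsMulti (monomial d r) (Finsupp.weight mdeg d) :=
      isWeightedHomogeneous_monomial mdeg d r rfl
    have h2 : IsMulti (trG p F m (monomial d r)) (Finsupp.weight mdeg d) := by
      rw [trG_apply]
      exact IsWeightedHomogeneous.sum _ _ _ fun g _ => h1.gsub g
    rw [← sum_weight_eq_degree hr]
    exact h2.isHomogeneous

theorem trG_mem_of_isHomogeneous {D : ℕ} (hm : 2 ≤ m) (hD : p + 1 ≤ D)
    (hD' : (p + m - 2) * (p - 1) ≤ D)
    {A : Subalgebra F (MvPolynomial (Fin m × Fin 2) F)} (hA : uld p F m ≤ A)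
    (hAD : ∀ f ∈ vectorInvariants p F m, ∀ n ≤ D, f.IsHomogeneous n → f ∈ A) (n : ℕ) :
    ∀ s : MvPolynomial (Fin m × Fin 2) F, s.IsHomogeneous n → trG p F m s ∈ A := by
  have hp := (Fact.out : p.Prime).one_lt
  induction n using Nat.strong_induction_on with
  | _ n ih =>
  intro s hs
  rcases le_or_gt n D with hn | hn
  · exact hAD _ (trG_mem s) n hn (isHomogeneous_trG hs)
  clear hAD
  induction hs using IsWeightedHomogeneous.induction_on with
  | zero => rw [map_zero]; exact zero_mem _
  | add f g _ _ hf hg => rw [map_add]; exact add_mem hf hg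
  | monomial d r hr =>
  obtain ⟨e, he⟩ : ∃ e, e = Finsupp.weight mdeg d := ⟨_, rfl⟩
  have h1 : IsMulti (monomial d r) e := isWeightedHomogeneous_monomial mdeg d r he.symm
  have hsum : ∑ i, e i = n := by
    rw [he, sum_weight_eq_degree hr]
  obtain ⟨q, rfl⟩ : ∃ q, p = q + 1 := ⟨p - 1, by lia⟩
  obtain ⟨l, rfl⟩ : ∃ l, m = l + 2 := ⟨m - 2, by lia⟩
  rw [Nat.add_sub_cancel, show q + 1 + (l + 2) - 2 = q + 1 + l by lia] at hD'
  -- Otherwise the degree is at most `m(p - 1)`, which does not exceed `D`.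
  obtain ⟨i, hi⟩ : ∃ i, q + 1 ≤ e i := by
    by_contra! hlt
    have : ∑ i, e i ≤ ∑ _i : Fin (l + 2), q := Finset.sum_le_sum fun i _ => Nat.le_of_lt_succ (hlt i)
    rw [Finset.sum_const, Finset.card_univ, Fintype.card_fin, smul_eq_mul] at this
    nlinarith
  by_cases hdvd : q ∣ n
  swap
  · exact trG_mem_of_not_dvd hA ih hsum hi (by lia) hdvd h1
  -- A multiple of `p - 1` above `(p + m - 2)(p - 1)` is at least the next multiple.
  have hlow : (q + 2 + l) * q ≤ n := by
    obtain ⟨c, rfl⟩ := hdvd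
    have h3 : q + 1 + l < c := by
      by_contra! hc
      nlinarith
    nlinarith
  by_cases hsq : (q + 1) ^ 2 ≤ n
  · refine trG_mem_of_sum_div hA ih hsum hi hsq ?_ h1
    rw [Nat.add_sub_cancel]
    -- If the quotients summed to at most `q - 1`, this would give `n ≤ q² - 1 + (l + 2) q`, one
    -- below the lower bound just found.
    have h4 : n ≤ (q + 1) * ∑ j, e j / (q + 1) + (l + 2) * q := by
      rw [← hsum, Finset.mul_sum]
      have : ∑ i, e i ≤ ∑ i, ((q + 1) * (e i / (q + 1)) + q) := Finset.sum_le_sum fun i _ => by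
        have h5 := Nat.div_add_mod (e i) (q + 1)
        have h6 := Nat.mod_lt (e i) (Nat.succ_pos q)
        lia
      rw [Finset.sum_add_distrib, Finset.sum_const, Finset.card_univ, Fintype.card_fin,
        smul_eq_mul] at this
      exact this
    by_contra! hlt
    have h5 : (∑ j, e j / (q + 1)) + 1 ≤ q := hlt
    nlinarith
  -- Below `(q + 1)²` the lower bound `q² + 2q + l q` leaves only `l = 0` and `n = p² - 1`.
  · have hl : l = 0 := by
      by_contra hl
      have : 1 ≤ l := Nat.one_le_iff_ne_zero.2 hl
      nlinarith
    subst hl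
    refine trG_mem_of_two hA ih hsum hi ?_ h1
    nlinarith

end Generation

/-! ### Upper and lower bounds for the Noether number -/

section Bounds

variable {p : ℕ} [Fact p.Prime] {F : Type*} [Field F] [CharP F p] {m : ℕ}

theorem isHomogeneous_uu (i j : Fin m) :
    (uu i j : MvPolynomial (Fin m × Fin 2) F).IsHomogeneous 2 := by
  have := (isMulti_uu (F := F) i j).isHomogeneous
  simpa [Finset.sum_add_distrib] using this

theorem isHomogeneous_ll (i j : Fin m) :
    (ll p i j : MvPolynomial (Fin m × Fin 2) F).IsHomogeneous (p + 1) := by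
  have := (isMulti_ll (p := p) (F := F) i j).isHomogeneous
  simpa [Finset.sum_add_distrib, ← Finset.mul_sum, add_comm] using this

theorem generatedInDegreeLE_vectorInvariants {D : ℕ} (hm : 2 ≤ m) (hD : p + 1 ≤ D)
    (hpD : p * (p - 1) ≤ D) (hD' : (p + m - 2) * (p - 1) ≤ D) :
    GeneratedInDegreeLE (vectorInvariants p F m) D := by
  have hp := (Fact.out : p.Prime).one_lt
  refine le_antisymm (Algebra.adjoin_le fun f hf => hf.1) ?_
  set A := Algebra.adjoin F {f | f ∈ vectorInvariants p F m ∧ ∃ n ≤ D, f.IsHomogeneous n}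
  have hAD : ∀ f ∈ vectorInvariants p F m, ∀ n ≤ D, f.IsHomogeneous n → f ∈ A :=
    fun f hf n hn hfn => Algebra.subset_adjoin ⟨hf, n, hn, hfn⟩
  have hA : uld p F m ≤ A := by
    refine Algebra.adjoin_le ?_
    rintro _ ((⟨ij, rfl⟩ | ⟨ij, rfl⟩) | ⟨b, hb, rfl⟩)
    · exact hAD _ (uu_mem _ _) 2 (by lia) (isHomogeneous_uu _ _)
    · exact hAD _ (ll_mem _ _) _ hD (isHomogeneous_ll _ _)
    · refine hAD _ (dd_mem b) _ ?_ (isHomogeneous_dd b)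
      rwa [show b.card = p - 1 from hb]
  intro f hf
  obtain ⟨k, hk, h, rfl⟩ := exists_uld_add_trG hf
  refine add_mem (hA hk) ?_
  rw [← MvPolynomial.sum_homogeneousComponent h, map_sum]
  exact sum_mem fun n _ => trG_mem_of_isHomogeneous hm hD hD' hA hAD n _
    (homogeneousComponent_isHomogeneous n h)

theorem noetherNumber_le {σ : Type*} {A : Subalgebra F (MvPolynomial σ F)} {d : ℕ}
    (h : GeneratedInDegreeLE A d) : noetherNumber A ≤ d :=
  iInf₂_le d h

theorem toPoly_gsub_unip (h : MvPolynomial (Fin m × Fin 2) F) :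
    toPoly F m (gsub (unip (1 : ZMod p)) h) = Polynomial.taylor 1 (toPoly F m h) := by
  have : (toPoly F m).comp (gsub (unip (1 : ZMod p))) =
      (Polynomial.taylorAlgHom 1).comp (toPoly F m) := by
    ext1 ⟨i, k⟩
    rw [AlgHom.comp_apply, AlgHom.comp_apply, gsub_X]
    fin_cases k <;> simp [toPoly, unip, add_comm]
  exact congrArg (fun φ => φ h) this

/-- Translation by `1` adds `n` times the coefficient of `T^n` to that of `T^(n-1)`. -/
theorem natCast_eq_zero_of_taylor_eq {q : Polynomial F} {n : ℕ} (hd : q.natDegree ≤ n)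
    (hc : q.coeff n ≠ 0) (hq : Polynomial.taylor 1 q = q) : (n : F) = 0 := by
  rcases n with _ | n
  · exact Nat.cast_zero
  have h1 := congrArg (fun r : Polynomial F => r.coeff n) hq
  simp only [Polynomial.taylor_coeff] at h1
  have h2 : (Polynomial.hasseDeriv n q).natDegree < 2 :=
    (Polynomial.natDegree_hasseDeriv_le q n).trans_lt (by lia)
  rw [Polynomial.eval_eq_sum_range' h2, Finset.sum_range_succ, Finset.sum_range_one,
    Polynomial.hasseDeriv_coeff, Polynomial.hasseDeriv_coeff] at h1
  simp [add_comm 1 n] at h1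
  exact_mod_cast h1.resolve_right hc

theorem evP_gsub_diag {c : ZMod p} (hc : c ≠ 0) (f : MvPolynomial (Fin m × Fin 2) F) :
    evP 0 1 (gsub (rowRep (c, 0)) f) = evP 0 (ZMod.castHom (dvd_refl p) F c⁻¹) f := by
  rw [evP_gsub]
  congr 2 <;> simp [rowRep, hc]

/-- The value at `(0, 1)` is the coefficient of `T^n` in the specialised polynomial. Unipotent
invariance then forces `p ∣ n`, and torus invariance forces `(p - 1) ∣ n`. -/
theorem dvd_of_evP_ne_zero {f : MvPolynomial (Fin m × Fin 2) F} {n : ℕ}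
    (hf : f ∈ vectorInvariants p F m) (hn : f.IsHomogeneous n) (h0 : evP 0 1 f ≠ 0) :
    p * (p - 1) ∣ n := by
  have hp := (Fact.out : p.Prime).one_lt
  rw [mem_vectorInvariants] at hf
  refine Nat.Coprime.mul_dvd_of_dvd_of_dvd ?_ ?_ ?_
  · exact (Nat.coprime_self_sub_right (by lia)).2 (Nat.coprime_one_right p)
  · obtain ⟨hd, hc⟩ := toPoly_natDegree_le hn
    rw [← CharP.cast_eq_zero_iff F p]
    refine natCast_eq_zero_of_taylor_eq hd (by rwa [hc]) ?_
    rw [← toPoly_gsub_unip (p := p), hf]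
  · have h1 := (FiniteField.forall_pow_eq_one_iff (ZMod p) n).1 fun c => by
      have h2 := congrArg (evP 0 1) (hf (rowRep ((c⁻¹ : (ZMod p)ˣ), 0)))
      have h3 := evP_smul hn (ZMod.castHom (dvd_refl p) F (c : ZMod p)) 0 1
      rw [evP_gsub_diag (Units.ne_zero _), Units.val_inv_eq_inv_val, inv_inv] at h2
      rw [mul_zero, mul_one, h2] at h3
      have h5 := mul_right_cancel₀ h0 ((one_mul _).trans h3)
      rw [← map_pow] at h5
      have := RingHom.injective (ZMod.castHom (dvd_refl p) F) (h5.symm.trans (map_one _).symm)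
      exact Units.ext (by simpa using this)
    rwa [ZMod.card] at h1

/-- The specialisation of every vector to `(0, T)`. -/
noncomputable def toPolyInf (F : Type*) [Field F] (m : ℕ) :
    MvPolynomial (Fin m × Fin 2) F →ₐ[F] Polynomial F :=
  aeval fun ik => ![0, Polynomial.X] ik.2

theorem toPolyInf_eq {h : MvPolynomial (Fin m × Fin 2) F} {n : ℕ} (hh : h.IsHomogeneous n) :
    toPolyInf F m h = Polynomial.C (evP 0 1 h) * Polynomial.X ^ n := by
  induction hh using IsWeightedHomogeneous.induction_on with
  | zero => simp
  | add f g _ _ hf hg => rw [map_add, map_add, hf, hg, map_add, add_mul]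
  | monomial d r hr =>
    have hs := sum_add_sum_eq_degree hr
    rw [toPolyInf, evP, aeval_monomial, aeval_monomial, Finsupp.prod_fintype _ _ (by simp),
      Finsupp.prod_fintype _ _ (by simp), Fintype.prod_prod_type, Fintype.prod_prod_type]
    simp only [Fin.prod_univ_two, Matrix.cons_val_zero, Matrix.cons_val_one, one_pow, mul_one,
      Finset.prod_mul_distrib, Finset.prod_pow_eq_pow_sum]
    rcases Nat.eq_zero_or_pos (∑ i, d (i, 0)) with h0 | h0
    · rw [h0, ← hs, h0]
      simp
    · rw [zero_pow h0.ne', zero_pow h0.ne']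
      simp

/-- Generators of degree below `p(p - 1)` restrict to constants on the line `(0, T)`, but `d_b` does
not. -/
theorem le_of_generatedInDegreeLE (hm : 0 < m) {d : ℕ}
    (hd : GeneratedInDegreeLE (vectorInvariants p F m) d) : p * (p - 1) ≤ d := by
  have hp := (Fact.out : p.Prime).one_lt
  by_contra! hlt
  have h1 : vectorInvariants p F m ≤ (⊥ : Subalgebra F (Polynomial F)).comap (toPolyInf F m) := by
    rw [← hd]
    refine Algebra.adjoin_le ?_
    rintro f ⟨hf, n, hn, hfn⟩
    change toPolyInf F m f ∈ (⊥ : Subalgebra F (Polynomial F))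
    rw [toPolyInf_eq hfn, Algebra.mem_bot]
    by_cases h0 : evP 0 1 f = 0
    · exact ⟨0, by rw [h0]; simp⟩
    · have h2 := Nat.eq_zero_of_dvd_of_lt (dvd_of_evP_ne_zero hf hfn h0) (by lia)
      exact ⟨evP 0 1 f, by rw [h2, pow_zero, mul_one]; rfl⟩
  have hb : (Multiset.replicate (p - 1) (⟨0, hm⟩ : Fin m)).card = p - 1 := by simp
  obtain ⟨c, hc⟩ := Algebra.mem_bot.1 (h1 (dd_mem (Multiset.replicate (p - 1) (⟨0, hm⟩ : Fin m))))
  change Polynomial.C c = toPolyInf F m _ at hc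
  rw [toPolyInf_eq (isHomogeneous_dd _), evP_zero_dd hb, hb, map_one, one_mul] at hc
  have h3 := congrArg Polynomial.natDegree hc
  rw [Polynomial.natDegree_C, Polynomial.natDegree_X_pow] at h3
  have : 0 < p * (p - 1) := Nat.mul_pos (by lia) (by lia)
  lia

theorem eq_zero_of_isHomogeneous_one {f : MvPolynomial (Fin m × Fin 2) F}
    (hf : f ∈ vectorInvariants p F m) (h1 : f.IsHomogeneous 1) : f = 0 := by
  classical
  rw [mem_vectorInvariants] at hf
  have h2 : f ∈ homogeneousSubmodule (Fin m × Fin 2) F 1 := h1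
  rw [homogeneousSubmodule_one_eq_span_X, Submodule.mem_span_range_iff_exists_fun] at h2
  obtain ⟨c, rfl⟩ := h2
  have hc1 : ∀ i, c (i, 1) = 0 := fun i => by
    have := congrArg (eval (Pi.single (i, 0) 1)) (hf (unip 1))
    simp only [Fintype.sum_prod_type, Fin.sum_univ_two, map_sum, map_add, map_smul, gsub_X,
      smul_eval] at this
    simpa [unip, Pi.single_apply, Finset.sum_add_distrib]
      using this
  have hc0 : ∀ i, c (i, 0) = 0 := fun i => by
    have := congrArg (eval (Pi.single (i, 1) 1)) (hf (translate 0))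
    simp only [Fintype.sum_prod_type, Fin.sum_univ_two, map_sum, map_add, map_smul, gsub_X,
      smul_eval] at this
    simpa [translate, Pi.single_apply,
      Finset.sum_add_distrib, hc1] using this
  refine Finset.sum_eq_zero ?_
  rintro ⟨i, k⟩ _
  fin_cases k
  · simp [hc0]
  · simp [hc1]

/-- With no linear invariants, generators of degree at most `2` produce only the even part of the
grading modulo `2`, whereas `l_01` is odd and nonzero. -/
theorem three_le_of_generatedInDegreeLE [CharP F 2] {d : ℕ}
    (hd : GeneratedInDegreeLE (vectorInvariants 2 F 2) d) : 3 ≤ d := by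
  by_contra! hlt
  have hwt : ∀ (f : MvPolynomial (Fin 2 × Fin 2) F) (n : ℕ), f.IsHomogeneous n →
      IsWeightedHomogeneous (fun _ => (1 : ZMod 2)) f (n : ZMod 2) := by
    intro f n hf
    have := IsWeightedHomogeneous.map_weight (Nat.castAddMonoidHom (ZMod 2)) hf
    simpa using this
  have h1 : ∀ f ∈ vectorInvariants 2 F 2,
      IsWeightedHomogeneous (fun _ => (1 : ZMod 2)) f 0 := by
    intro f hf
    rw [← hd] at hf
    induction hf using Algebra.adjoin_induction with
    | mem f hf =>
      obtain ⟨hf, n, hn, hfn⟩ := hf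
      have h2 := hwt f n hfn
      have hn2 : n ≤ 2 := by lia
      interval_cases n
      · exact h2
      · rw [eq_zero_of_isHomogeneous_one hf hfn]
        exact isWeightedHomogeneous_zero _ _ _
      · exact h2
    | algebraMap r => exact isWeightedHomogeneous_C _ r
    | add f g _ _ hf hg => exact hf.add hg
    | mul f g _ _ hf hg => simpa using hf.mul hg
  have h2 := h1 _ (ll_mem (p := 2) 0 1)
  have h3 := hwt _ _ (isHomogeneous_ll (p := 2) (F := F) (0 : Fin 2) 1)
  have h4 : (ll 2 0 1 : MvPolynomial (Fin 2 × Fin 2) F) ≠ 0 := by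
    intro h
    have := congrArg (eval fun ik : Fin 2 × Fin 2 => if ik = (0, 0) ∨ ik = (1, 1) then (1 : F) else 0) h
    simp [ll] at this
  exact absurd (IsWeightedHomogeneous.inj_right h4 h2 h3) (by decide)

end Bounds

end SL2Vector

theorem mainTheorem6 (p : ℕ) [Fact p.Prime] (F : Type*) [Field F] [CharP F p] :
    (∀ m : ℕ, 2 < m →
      SL2Vector.noetherNumber (SL2Vector.vectorInvariants p F m) ≤
        (((p + m - 2) * (p - 1) : ℕ) : ℕ∞)) ∧
    (2 < p →
      SL2Vector.noetherNumber (SL2Vector.vectorInvariants p F 2) = ((p * (p - 1) : ℕ) : ℕ∞)) ∧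
    (p = 2 →
      SL2Vector.noetherNumber (SL2Vector.vectorInvariants p F 2) = 3) := by
  have hp := (Fact.out : p.Prime).one_lt
  refine ⟨fun m hm => ?_, fun hp2 => le_antisymm ?_ ?_, ?_⟩
  · refine SL2Vector.noetherNumber_le (SL2Vector.generatedInDegreeLE_vectorInvariants hm.le ?_ ?_
      le_rfl)
    · obtain ⟨q, rfl⟩ : ∃ q, p = q + 2 := ⟨p - 2, by lia⟩
      obtain ⟨l, rfl⟩ : ∃ l, m = l + 3 := ⟨m - 3, by lia⟩
      rw [show q + 2 + (l + 3) - 2 = q + l + 3 by lia, show q + 2 - 1 = q + 1 by lia]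
      nlinarith
    · exact Nat.mul_le_mul_right _ (by lia)
  · refine SL2Vector.noetherNumber_le (SL2Vector.generatedInDegreeLE_vectorInvariants le_rfl ?_
      le_rfl (by simp))
    obtain ⟨q, rfl⟩ : ∃ q, p = q + 3 := ⟨p - 3, by lia⟩
    rw [show q + 3 - 1 = q + 2 by lia]
    nlinarith
  · exact le_iInf₂ fun d hd => by
      exact_mod_cast SL2Vector.le_of_generatedInDegreeLE two_pos hd
  · rintro rfl
    refine le_antisymm ?_ ?_
    -- For `p = 2` the binding constraint is `p + 1`, the degree of the `l_ij`, since `p(p - 1)` is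
    -- only `2`.
    · exact SL2Vector.noetherNumber_le (SL2Vector.generatedInDegreeLE_vectorInvariants (D := 3)
        le_rfl le_rfl (by simp) (by simp))
    · exact le_iInf₂ fun d hd => by
        exact_mod_cast SL2Vector.three_le_of_generatedInDegreeLE hd
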